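/- Let $L>0$, let $\mathbb T^2=\mathbb R^2/(\mathbb Z\times L\mathbb Z)$ with coordinates $(x,y)$, oriented by $dx\wedge dy$, and let $a:\mathbb R/\mathbb Z\to(0,\infty)$ and $b:\mathbb R/\mathbb Z\to\mathbb R$ be smooth functions such that $$\Big|\frac{da}{dx}\Big|<ab\qquad\text{everywhere}.$$ Consider the Riemannian metric $g=dx^2+a(x)^2dy^2$ on $\mathbb T^2$, with area form $\mu_g=a\,dx\wedge dy$, and the magnetic function $b=b(x)$, with average $\langle b\rangle=\int_{\mathbb T^2} b\,\mu_g\big/\int_{\mathbb T^2}\mu_g$. A $(g,b)$-geodesic is a unit-speed curve $\gamma:\mathbb R\to\mathbb T^2$ with geodesic curvature $\kappa_\gamma=b\circ\gamma$. The magnetic flow on the unit tangent bundle $\pi:S\mathbb T^2\to\mathbb T^2$ is $\Phi^t(\gamma(0),\dot\gamma(0))=(\gamma(t),\dot\gamma(t))$, for $\gamma$ a $(g,b)$-geodesic. The system $(g,b)$ is called Zoll if the flow yields a free circle action, that is, if there is a smooth free action of $S^1$ on $S\mathbb T^2$ whose orbits are orientation-preserving reparametrizations of the orbits of $\Phi$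 (the orbits of $\Phi$ need not all have the same period). Let $\Lambda^+(g,b)$ be the set of closed $(g,b)$-geodesics $\gamma$ whose lift $(\gamma,\dot\gamma)$ to $S\mathbb T^2$ is freely homotopic, as a loop, to an oriented fibre of $\pi$ (equivalently, $\gamma$ is contractible with turning number $+1$). For $\gamma\in\Lambda^+(g,b)$ let $$\ell_{(g,b)}(\gamma)=\ell_g(\gamma)-\int_{D^2}\Gamma^*(b\,\mu_g),$$ where $\ell_g$ is the $g$-length and $\Gamma:D^2\to\mathbb T^2$ is a capping disc of $\gamma$ obtained by projecting to $\mathbb T^2$ a homotopy between $(\gamma,\dot\gamma)$ and a fibre of $\pi$ (the value does not depend on the choice of $\Gamma$). Then $\Lambda^+(g,b)$ is non-empty, $\ell_{(g,b)}$ is bounded below on it, and $$\inf_{\gamma\in\Lambda^+(g,b)}\ell_{(g,b)}(\gamma)\le\frac{\pi}{\langle b\rangle}.$$ Equality holds if and only if $(g,b)$ is Zoll. -/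

import Mathlib

open scoped ContDiff

noncomputable section

namespace MagneticTorus

/-- The two-torus `ℝ² / (ℤ × Lℤ)`, with angular coordinates `(x, y)`. -/
abbrev Torus (L : ℝ) : Type := AddCircle (1 : ℝ) × AddCircle L

/-- The universal covering `ℝ² → ℝ² / (ℤ × Lℤ)`. -/
def proj (L : ℝ) (p : Fin 2 → ℝ) : Torus L := ((p 0 : AddCircle (1 : ℝ)), (p 1 : AddCircle L))

/-- A magnetic system on the torus: a smooth Riemannian metric `g`, given by its matrix in the
coordinate frame `∂_x, ∂_y`, and a smooth magnetic function `b`. The torus is oriented by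
`dx ∧ dy`, and its tangent bundle is trivialised by the frame `∂_x, ∂_y`. -/
structure MagneticSystem (L : ℝ) where
  g : Torus L → Matrix (Fin 2) (Fin 2) ℝ
  b : Torus L → ℝ
  g_posDef : ∀ q, (g q).PosDef
  g_smooth : ∀ i j, ContDiff ℝ ∞ fun p : Fin 2 → ℝ => g (proj L p) i j
  b_smooth : ContDiff ℝ ∞ fun p : Fin 2 → ℝ => b (proj L p)

namespace MagneticSystem

variable {L : ℝ} (M : MagneticSystem L)

/-- The scalar product `g_q(u, v)` of two tangent vectors at `q`. -/
def metric (q : Torus L) (u v : Fin 2 → ℝ) : ℝ := ∑ i, ∑ j, M.g q i j * u i * v j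

/-- The length `|v|_g` of a tangent vector at `q`. -/
def speed (q : Torus L) (v : Fin 2 → ℝ) : ℝ := √(M.metric q v v)

/-- The density of the area form: `μ_g = areaDensity dx ∧ dy`. -/
def areaDensity (q : Torus L) : ℝ := √((M.g q).det)

/-- The vector `v^⊥`, the rotation of `v` by `π / 2` in the positive direction with respect to
the metric at `q`. -/
def perp (q : Torus L) (v : Fin 2 → ℝ) : Fin 2 → ℝ :=
  (M.areaDensity q)⁻¹ •
    ![-(M.g q 1 0 * v 0 + M.g q 1 1 * v 1), M.g q 0 0 * v 0 + M.g q 0 1 * v 1]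

/-- The partial derivative at `p` in the `l`-th coordinate of the metric coefficient `g_{ij}`. -/
def dg (l i j : Fin 2) (p : Fin 2 → ℝ) : ℝ :=
  fderiv ℝ (fun z : Fin 2 → ℝ => M.g (proj L z) i j) p (Pi.single l 1)

/-- The Christoffel symbol `Γ^k_{ij}` of the Levi-Civita connection of `g` at `p`. -/
def christoffel (k i j : Fin 2) (p : Fin 2 → ℝ) : ℝ :=
  (1 / 2) * ∑ l, (M.g (proj L p))⁻¹ k l * (M.dg i j l p + M.dg j i l p - M.dg l i j p)

/-- The covariant acceleration `∇_γ' γ'` at time `t` of the curve `γ` on the torus which is covered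
by the curve `c` in the plane. -/
def acceleration (c : ℝ → Fin 2 → ℝ) (t : ℝ) : Fin 2 → ℝ := fun k =>
  deriv (deriv c) t k + ∑ i, ∑ j, M.christoffel k i j (c t) * deriv c t i * deriv c t j

/-- The geodesic curvature at time `t` of a unit-speed curve covered by `c`. -/
def geodesicCurvature (c : ℝ → Fin 2 → ℝ) (t : ℝ) : ℝ :=
  M.metric (proj L (c t)) (M.acceleration c t) (M.perp (proj L (c t)) (deriv c t))

/-- The curve on the torus covered by `c` is a `(g, b)`-geodesic: it is a smooth unit-speed curve
whose geodesic curvature is prescribed by `b`. -/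
def IsGeodesic (c : ℝ → Fin 2 → ℝ) : Prop :=
  ContDiff ℝ ∞ c ∧ (∀ t, M.metric (proj L (c t)) (deriv c t) (deriv c t) = 1) ∧
    ∀ t, M.geodesicCurvature c t = M.b (proj L (c t))

/-- The unit tangent bundle of the torus with respect to `g`. -/
abbrev UnitTangent : Type := {w : Torus L × (Fin 2 → ℝ) // M.metric w.1 w.2 w.2 = 1}

/-- The average `⟨b⟩` of the magnetic function with respect to the area form of `g`. -/
def average : ℝ :=
  (∫ x in (0 : ℝ)..1, ∫ y in (0 : ℝ)..L, M.b (proj L ![x, y]) * M.areaDensity (proj L ![x, y])) /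
    ∫ x in (0 : ℝ)..1, ∫ y in (0 : ℝ)..L, M.areaDensity (proj L ![x, y])

end MagneticSystem

/-- A smooth regular closed curve on the torus, described by a curve `toFun` in the plane which
covers it and by a (not necessarily minimal) period `T`. -/
structure ClosedCurve (L : ℝ) where
  toFun : ℝ → Fin 2 → ℝ
  T : ℝ
  T_pos : 0 < T
  smooth : ContDiff ℝ ∞ toFun
  regular : ∀ t, deriv toFun t ≠ 0
  closed : ∀ t, proj L (toFun (t + T)) = proj L (toFun t)

namespace MagneticSystem

variable {L : ℝ} (M : MagneticSystem L)

/-- `H` is a free homotopy of loops in the unit tangent bundle, from an oriented fibre over some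
point `q` (at time `0`) to the lift `(γ, γ' / |γ'|)` of the closed curve `γ` (at time `1`). -/
def IsHomotopyFromFibre (γ : ClosedCurve L)
    (H : C(unitInterval × AddCircle (1 : ℝ), M.UnitTangent)) : Prop :=
  (∃ w : M.UnitTangent, ∀ s : ℝ, (H (0, (s : AddCircle (1 : ℝ)))).1 =
    (w.1.1, Real.cos (2 * Real.pi * s) • w.1.2
      + Real.sin (2 * Real.pi * s) • M.perp w.1.1 w.1.2)) ∧
  ∀ s : ℝ, (H (1, (s : AddCircle (1 : ℝ)))).1 =
    (proj L (γ.toFun (s * γ.T)),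
      (M.speed (proj L (γ.toFun (s * γ.T))) (deriv γ.toFun (s * γ.T)))⁻¹ •
        deriv γ.toFun (s * γ.T))

/-- The class `Λ⁺` of closed curves whose lift to the unit tangent bundle is homotopic to an
oriented fibre. -/
def LambdaPlus : Set (ClosedCurve L) := {γ | ∃ H, M.IsHomotopyFromFibre γ H}

/-- The set `Λ⁺(g, b)` of the `(g, b)`-geodesics in the class `Λ⁺`. -/
def LambdaPlusGeodesics : Set (ClosedCurve L) := {γ | γ ∈ M.LambdaPlus ∧ M.IsGeodesic γ.toFun}

/-- `Γ` is a capping disc of `γ`, obtained by projecting to the torus a homotopy between the lift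
of `γ` and a fibre. The disc is written in polar coordinates (radius `r ∈ [0, 1]`, angle `2πs`):
it is constant for `r = 0` and is the curve `γ` for `r = 1`. As its domain is simply connected,
the disc is given through a covering map into the plane. -/
def IsCappingDisc (γ : ClosedCurve L) (Γ : ℝ × ℝ → Fin 2 → ℝ) : Prop :=
  ContDiff ℝ ∞ Γ ∧ ∃ H, M.IsHomotopyFromFibre γ H ∧
    ∀ (r : unitInterval) (s : ℝ), (H (r, (s : AddCircle (1 : ℝ)))).1.1 = proj L (Γ ((r : ℝ), s))

/-- The integral of `Γ^* (b μ_g)` over the disc, in polar coordinates. -/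
def flux (Γ : ℝ × ℝ → Fin 2 → ℝ) : ℝ :=
  ∫ r in (0 : ℝ)..1, ∫ s in (0 : ℝ)..1,
    M.b (proj L (Γ (r, s))) * M.areaDensity (proj L (Γ (r, s))) *
      (fderiv ℝ Γ (r, s) (1, 0) 0 * fderiv ℝ Γ (r, s) (0, 1) 1
        - fderiv ℝ Γ (r, s) (1, 0) 1 * fderiv ℝ Γ (r, s) (0, 1) 0)

/-- The Riemannian length of a closed curve. -/
def length (γ : ClosedCurve L) : ℝ :=
  ∫ t in (0 : ℝ)..γ.T, M.speed (proj L (γ.toFun t)) (deriv γ.toFun t)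

/-- The magnetic length of a closed curve `γ` with capping disc `Γ`. On the torus it does not depend
on the choice of the capping disc. -/
def magneticLength (γ : ClosedCurve L) (Γ : ℝ × ℝ → Fin 2 → ℝ) : ℝ := M.length γ - M.flux Γ

/-- The set of the values of the magnetic length functional on `Λ⁺(g, b)`. -/
def magneticLengths : Set ℝ :=
  {l | ∃ γ ∈ M.LambdaPlusGeodesics, ∃ Γ, M.IsCappingDisc γ Γ ∧ l = M.magneticLength γ Γ}

/-- `Φ` is the magnetic flow on the unit tangent bundle: `Φ^t (q, v) = (γ(t), γ'(t))`, where `γ` is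
the `(g, b)`-geodesic with `(γ(0), γ'(0)) = (q, v)`. -/
def IsFlow (Φ : ℝ → M.UnitTangent → M.UnitTangent) : Prop :=
  ∀ w, Φ 0 w = w ∧ ∃ c, M.IsGeodesic c ∧ ∀ t, (Φ t w).1 = (proj L (c t), deriv c t)

/-- Smooth real functions on the unit tangent bundle: those which, in the coordinates
`(x, y, v_x, v_y)`, are restrictions of smooth functions of a point and a nonzero vector. -/
def IsSmoothFunction (f : M.UnitTangent → ℝ) : Prop :=
  ∃ F : (Fin 2 → ℝ) × (Fin 2 → ℝ) → ℝ, ContDiffOn ℝ ∞ F {z | z.2 ≠ 0} ∧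
    ∀ (p v : Fin 2 → ℝ) (h : M.metric (proj L p) v v = 1), f ⟨(proj L p, v), h⟩ = F (p, v)

/-- Smoothness of a map `S¹ × SΣ → SΣ`, where `S¹ = ℝ / ℤ` and `SΣ` is the unit tangent bundle:
the pull-back of every smooth function is a smooth function on the product. -/
def IsSmoothCircleFamily (ψ : AddCircle (1 : ℝ) → M.UnitTangent → M.UnitTangent) : Prop :=
  ∀ f, M.IsSmoothFunction f →
    ∃ F : ℝ × (Fin 2 → ℝ) × (Fin 2 → ℝ) → ℝ, ContDiffOn ℝ ∞ F {z | z.2.2 ≠ 0} ∧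
      ∀ (s : ℝ) (p v : Fin 2 → ℝ) (h : M.metric (proj L p) v v = 1),
        f (ψ (s : AddCircle (1 : ℝ)) ⟨(proj L p, v), h⟩) = F (s, p, v)

/-- The magnetic system is Zoll: the magnetic flow yields a free action of the circle `ℝ / ℤ` on the
unit tangent bundle, that is, there is a smooth free circle action each of whose orbits is an
orientation-preserving reparametrisation of an orbit of the flow. -/
def IsZoll : Prop :=
  ∃ Φ, M.IsFlow Φ ∧ ∃ ψ : AddCircle (1 : ℝ) → M.UnitTangent → M.UnitTangent,
    (∀ w, ψ 0 w = w) ∧ (∀ s t w, ψ (s + t) w = ψ s (ψ t w)) ∧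
    (∀ s w, ψ s w = w → s = 0) ∧
    M.IsSmoothCircleFamily ψ ∧
    ∀ w, ∃ σ : ℝ ≃o ℝ, ∀ s : ℝ, ψ (s : AddCircle (1 : ℝ)) w = Φ (σ s) w

end MagneticSystem

/-- The rotationally symmetric magnetic system `g = dx² + a(x)² dy²`, `b = b(x)`. -/
def rotSym (L : ℝ) (a b : AddCircle (1 : ℝ) → ℝ) (ha : ContDiff ℝ ∞ fun x : ℝ => a x)
    (hb : ContDiff ℝ ∞ fun x : ℝ => b x) (hpos : ∀ x, 0 < a x) : MagneticSystem L where
  g q := Matrix.diagonal ![1, a q.1 ^ 2]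
  b q := b q.1
  g_posDef q := by
    refine Matrix.PosDef.diagonal fun i => ?_
    have := hpos q.1
    fin_cases i
    · simp
    · simpa using pow_pos this 2
  g_smooth i j := by
    have h : ContDiff ℝ ∞ fun p : Fin 2 → ℝ => a (p 0 : AddCircle (1 : ℝ)) :=
      ha.comp (contDiff_apply ℝ ℝ (0 : Fin 2))
    fin_cases i <;> fin_cases j <;> simp [Matrix.diagonal, proj]
    · exact contDiff_const
    · exact contDiff_const
    · exact contDiff_const
    · exact h.pow 2
  b_smooth := hb.comp (contDiff_apply ℝ ℝ (0 : Fin 2))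

end MagneticTorus

end

open scoped ContDiff

noncomputable section

namespace MagneticTorus

open Set Filter Topology MeasureTheory Real

/-! Let `θ` be the angle of a unit-speed geodesic with `∂_x`. The geodesic equation reads `x' = cos
θ`, `y' = sin θ / a`, `θ' = (a b - a' sin θ) / a`, and the hypothesis `|a'| < a b` makes `θ`
strictly increasing, so the angle can replace time as the parameter. If `B` is a primitive of `a b`,
the quantity `c = B(x) - a(x) sin θ` is conserved (Clairaut). By the same hypothesis it is strictly
increasing in `x` at fixed `θ`, so an orbit is a graph `x = X(θ, c)`. After a full turn `x` returns
to itself and `y` has moved by `W(c)`.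

The lift of a geodesic in `Λ⁺` is homotopic to a fibre, so its angle grows by `2π` over its period,
and it closes up in the plane; hence `W(c) = 0`. Since `b μ_g = d(B dy)`, Stokes and the Clairaut
integral give its magnetic length as `F(c) = ∫ cos² φ (dt/dφ) dφ` over one turn. The key identity is
`F' = W` (`hasDerivAt_F`): the magnetic lengths on `Λ⁺` are exactly the critical values of `F`. As
`F` is periodic with period `P = B(1)`, it attains its minimum, which is the infimum sought.

The substitution `x = X(φ, c)` gives `∫₀ᴾ F = π ∫ a` (`integral_F`), so the mean of `F` is `π ∫ a /
∫ a b = π / ⟨b⟩`. The minimum is at most the mean, with equality if and only if `F` is constant,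
that is, `W = 0` identically. In that case turning the angle by `2π s` along the orbits is a free
circle action (`isZoll_of_W_eq_zero`). Conversely, in a Zoll system every orbit closes after some
number of turns, so `W` takes values in `ℚ L`; being continuous it is constant, and it vanishes at a
minimum of `F` (`W_eq_zero_of_rational`). -/

/-! ### Smooth inverses, integrals with parameters, quasi-periodic functions. -/

/-- Injectivity of `f` forces `g` to agree near each point with the local inverse from the inverse
function theorem, so continuity of `g` need not be assumed. -/
theorem contDiff_of_rightInverse {E : Type*} [NormedAddCommGroup E] [NormedSpace ℝ E]
    [CompleteSpace E] {f g : E → E} (hf : ContDiff ℝ ∞ f)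
    (hinj : Function.Injective f) (hfg : ∀ z, f (g z) = z)
    (hf' : ∀ z, ∃ e : E ≃L[ℝ] E, HasFDerivAt f (e : E →L[ℝ] E) z) : ContDiff ℝ ∞ g := by
  rw [contDiff_iff_contDiffAt]
  intro z
  obtain ⟨e, he⟩ := hf' (g z)
  have hfz : ContDiffAt ℝ ∞ f (g z) := hf.contDiffAt
  have hn : (∞ : WithTop ℕ∞) ≠ 0 := by simp
  have h1 := hfz.to_localInverse he hn
  rw [hfg] at h1
  refine h1.congr_of_eventuallyEq ?_
  have h2 := (hfz.hasStrictFDerivAt' he hn).eventually_right_inverse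
  rw [hfg] at h2
  filter_upwards [h2] with w hw
  exact hinj ((hfg w).trans hw.symm)

theorem hasFDerivAt_intervalIntegral {E F : Type*} [NormedAddCommGroup E] [NormedSpace ℝ E]
    [FiniteDimensional ℝ E] [NormedAddCommGroup F] [NormedSpace ℝ F] {h : E × ℝ → F}
    (hh : ContDiff ℝ 1 h) (u v : ℝ) (z : E) :
    HasFDerivAt (fun z => ∫ s in u..v, h (z, s))
      (∫ s in u..v, (fderiv ℝ h (z, s)).comp (ContinuousLinearMap.inl ℝ E ℝ)) z := by
  have hp : ProperSpace E := FiniteDimensional.proper_real E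
  have hc : Continuous fun w : E × ℝ =>
      (fderiv ℝ h w).comp (ContinuousLinearMap.inl ℝ E ℝ) :=
    (hh.continuous_fderiv (by simp)).clm_comp continuous_const
  have hK : IsCompact (Metric.closedBall z 1 ×ˢ uIcc u v) :=
    (isCompact_closedBall z 1).prod isCompact_uIcc
  obtain ⟨C, hC⟩ := hK.exists_bound_of_continuousOn hc.continuousOn
  have hcz : ∀ z : E, Continuous fun s : ℝ => h (z, s) := fun z =>
    hh.continuous.comp (by fun_prop)
  refine (intervalIntegral.hasFDerivAt_integral_of_dominated_of_fderiv_le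
    (F' := fun z s => (fderiv ℝ h (z, s)).comp (ContinuousLinearMap.inl ℝ E ℝ))
    (bound := fun _ => C) (Metric.closedBall_mem_nhds z one_pos)
    (Eventually.of_forall fun w => (hcz w).aestronglyMeasurable)
    ((hcz z).intervalIntegrable _ _)
    (hc.comp (by fun_prop : Continuous fun s : ℝ => (z, s))).aestronglyMeasurable
    (Eventually.of_forall fun s hs w hw => hC (w, s) ⟨hw, uIoc_subset_uIcc hs⟩)
    (by simp) (Eventually.of_forall fun s hs w hw => ?_))
  have h1 := (hh.differentiable (by simp) (w, s)).hasFDerivAt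
  exact h1.comp w (hasFDerivAt_prodMk_left w s)

/-- The derivative of such an integral is again such an integral, with values in `E →L[ℝ] F`; hence
the induction generalises `F`, and both spaces live in `Type` so that `F` can be replaced. -/
theorem contDiff_parametric_intervalIntegral {E F : Type} [NormedAddCommGroup E] [NormedSpace ℝ E]
    [FiniteDimensional ℝ E] [NormedAddCommGroup F] [NormedSpace ℝ F] {h : E × ℝ → F}
    (hh : ContDiff ℝ ∞ h) (u v : ℝ) : ContDiff ℝ ∞ fun z => ∫ s in u..v, h (z, s) := by
  rw [contDiff_infty]
  intro n
  induction n generalizing F with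
  | zero =>
    simp only [Nat.cast_zero, contDiff_zero]
    exact intervalIntegral.continuous_parametric_intervalIntegral_of_continuous'
      (f := fun z s => h (z, s)) hh.continuous u v
  | succ n ih =>
    have hd := hasFDerivAt_intervalIntegral (hh.of_le (by exact_mod_cast le_top)) u v
    rw [Nat.cast_succ, contDiff_succ_iff_fderiv]
    refine ⟨fun z => (hd z).differentiableAt, by simp, ?_⟩
    have : fderiv ℝ (fun z => ∫ s in u..v, h (z, s)) = fun z =>
        ∫ s in u..v, (fderiv ℝ h (z, s)).comp (ContinuousLinearMap.inl ℝ E ℝ) := by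
      ext1 z; exact (hd z).fderiv
    rw [this]
    exact ih (h := fun w => (fderiv ℝ h w).comp (ContinuousLinearMap.inl ℝ E ℝ))
      ((hh.fderiv_right (by simp)).clm_comp contDiff_const)

/-- Rescaling by `φ = z.1 * s` moves the variable end point into the integrand. -/
theorem contDiff_primitive {h : ℝ × ℝ → ℝ} (hh : ContDiff ℝ ∞ h) :
    ContDiff ℝ ∞ fun z : ℝ × ℝ => ∫ φ in (0 : ℝ)..z.1, h (φ, z.2) := by
  have : (fun z : ℝ × ℝ => ∫ φ in (0 : ℝ)..z.1, h (φ, z.2)) =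
      fun z : ℝ × ℝ => z.1 * ∫ s in (0 : ℝ)..1, h (z.1 * s, z.2) := by
    ext z
    have := intervalIntegral.mul_integral_comp_mul_left (a := 0) (b := 1)
      (f := fun φ => h (φ, z.2)) z.1
    simpa using this.symm
  rw [this]
  refine contDiff_fst.mul (contDiff_parametric_intervalIntegral
    (h := fun w : (ℝ × ℝ) × ℝ => h (w.1.1 * w.2, w.1.2)) (hh.comp ?_) 0 1)
  fun_prop

theorem contDiff_slice_left {f : ℝ → ℝ → ℝ} (hf : ContDiff ℝ ∞ fun z : ℝ × ℝ => f z.1 z.2)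
    (c : ℝ) : ContDiff ℝ ∞ fun θ => f θ c :=
  ContDiff.comp (g := fun z : ℝ × ℝ => f z.1 z.2) (f := fun θ => (θ, c)) hf (by fun_prop)

theorem contDiff_slice_right {f : ℝ → ℝ → ℝ} (hf : ContDiff ℝ ∞ fun z : ℝ × ℝ => f z.1 z.2)
    (θ : ℝ) : ContDiff ℝ ∞ fun c => f θ c :=
  ContDiff.comp (g := fun z : ℝ × ℝ => f z.1 z.2) (f := fun c => (θ, c)) hf (by fun_prop)

theorem contDiff_uncurry_comp {E : Type*} [NormedAddCommGroup E] [NormedSpace ℝ E]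
    {f : ℝ → ℝ → ℝ} (hf : ContDiff ℝ ∞ fun z : ℝ × ℝ => f z.1 z.2) {u v : E → ℝ}
    (hu : ContDiff ℝ ∞ u) (hv : ContDiff ℝ ∞ v) : ContDiff ℝ ∞ fun z => f (u z) (v z) :=
  ContDiff.comp (g := fun z : ℝ × ℝ => f z.1 z.2) (f := fun z => (u z, v z)) hf (hu.prodMk hv)

theorem add_int_mul_of_add_const {f : ℝ → ℝ} {p q : ℝ} (h : ∀ x, f (x + p) = f x + q) (x : ℝ)
    (n : ℤ) : f (x + n * p) = f x + n * q := by
  induction n using Int.induction_on with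
  | zero => simp
  | succ n ih =>
    push_cast at ih ⊢
    rw [add_mul, one_mul, ← add_assoc, h, ih]; ring
  | pred n ih =>
    have := h (x + (-(n : ℤ) - 1 : ℤ) * p)
    push_cast at ih this ⊢
    rw [show x + (-(n : ℝ) - 1) * p + p = x + -(n : ℝ) * p by ring, ih] at this
    linarith

theorem surjective_of_add_const {f : ℝ → ℝ} {p q : ℝ} (hq : 0 < q) (hc : Continuous f)
    (h : ∀ x, f (x + p) = f x + q) : Function.Surjective f := by
  intro c
  obtain ⟨n, hn⟩ := exists_int_gt ((c - f 0) / q)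
  obtain ⟨m, hm⟩ := exists_int_lt ((c - f 0) / q)
  have h1 := add_int_mul_of_add_const h 0 n
  have h2 := add_int_mul_of_add_const h 0 m
  rw [div_lt_iff₀ hq] at hn
  rw [lt_div_iff₀ hq] at hm
  exact mem_range_of_exists_le_of_exists_ge hc ⟨_, (by rw [h2]; linarith : f (0 + m * p) ≤ c)⟩
    ⟨_, (by rw [h1]; linarith : c ≤ f (0 + n * p))⟩

/-! ### The Clairaut integral and orbits parametrised by their angle. -/

/-- A rotationally symmetric magnetic system, lifted to the line: 1-periodic functions `a`, `b`
with `|a'| < a b`. -/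
structure Profile where
  a : ℝ → ℝ
  b : ℝ → ℝ
  a_smooth : ContDiff ℝ ∞ a
  b_smooth : ContDiff ℝ ∞ b
  a_periodic : Function.Periodic a 1
  b_periodic : Function.Periodic b 1
  a_pos : ∀ x, 0 < a x
  abs_deriv_lt : ∀ x, |deriv a x| < a x * b x

namespace Profile

variable (S : Profile)

/-- The primitive of `a b` vanishing at `0`. -/
def B (x : ℝ) : ℝ := ∫ t in (0 : ℝ)..x, S.a t * S.b t

/-- The increment of `B` over a period. -/
def P : ℝ := S.B 1

/-- The `x`-derivative of the Clairaut integral. -/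
def den (θ x : ℝ) : ℝ := S.a x * S.b x - deriv S.a x * sin θ

/-- The Clairaut integral of the magnetic flow. -/
def clairaut (θ x : ℝ) : ℝ := S.B x - S.a x * sin θ

theorem ab_smooth : ContDiff ℝ ∞ fun x => S.a x * S.b x := S.a_smooth.mul S.b_smooth

theorem deriv_a_smooth : ContDiff ℝ ∞ (deriv S.a) :=
  ((contDiff_infty_iff_deriv (𝕜 := ℝ)).1 S.a_smooth).2

theorem hasDerivAt_a (x : ℝ) : HasDerivAt S.a (deriv S.a x) x :=
  (S.a_smooth.differentiable (by simp) x).hasDerivAt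

theorem hasDerivAt_B (x : ℝ) : HasDerivAt S.B (S.a x * S.b x) x :=
  intervalIntegral.integral_hasDerivAt_right (S.ab_smooth.continuous.intervalIntegrable _ _)
    (S.ab_smooth.continuous.stronglyMeasurableAtFilter _ _) S.ab_smooth.continuous.continuousAt

theorem B_smooth : ContDiff ℝ ∞ S.B := by
  rw [contDiff_infty_iff_deriv]
  refine ⟨fun x => (S.hasDerivAt_B x).differentiableAt, ?_⟩
  rw [funext fun x => (S.hasDerivAt_B x).deriv]
  exact S.ab_smooth

theorem ab_pos (x : ℝ) : 0 < S.a x * S.b x := (abs_nonneg _).trans_lt (S.abs_deriv_lt x)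

theorem B_add_one (x : ℝ) : S.B (x + 1) = S.B x + S.P := by
  have hp : Function.Periodic (fun t => S.a t * S.b t) 1 := S.a_periodic.mul S.b_periodic
  have hi := fun u v => S.ab_smooth.continuous.intervalIntegrable (μ := volume) u v
  have h := hp.intervalIntegral_add_eq x 0
  have := intervalIntegral.integral_add_adjacent_intervals (hi 0 x) (hi x (x + 1))
  simp only [B, P]
  rw [← this, h, zero_add]

theorem P_pos : 0 < S.P :=
  intervalIntegral.intervalIntegral_pos_of_pos (S.ab_smooth.continuous.intervalIntegrable _ _)
    S.ab_pos one_pos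

theorem deriv_a_periodic : Function.Periodic (deriv S.a) 1 := by
  intro x
  have : S.a = fun x => S.a (x + 1) := funext fun x => (S.a_periodic x).symm
  conv_rhs => rw [this]
  rw [deriv_comp_add_const]

/-- The hypothesis `|a'| < a b` acts through this positivity: it makes the Clairaut integral
increase in `x`, and later the angle increase in time. -/
theorem den_pos (θ x : ℝ) : 0 < S.den θ x := by
  have h := S.abs_deriv_lt x
  have : |deriv S.a x * sin θ| ≤ |deriv S.a x| := by
    rw [abs_mul]; exact mul_le_of_le_one_right (abs_nonneg _) (abs_sin_le_one θ)
  have h2 := le_abs_self (deriv S.a x * sin θ)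
  unfold den; linarith

theorem clairaut_add_one (θ x : ℝ) : S.clairaut θ (x + 1) = S.clairaut θ x + S.P := by
  simp only [clairaut, S.B_add_one, S.a_periodic x]; ring

theorem hasDerivAt_clairaut (θ x : ℝ) : HasDerivAt (S.clairaut θ) (S.den θ x) x :=
  (S.hasDerivAt_B x).sub ((S.hasDerivAt_a x).mul_const _)

theorem clairaut_smooth : ContDiff ℝ ∞ fun z : ℝ × ℝ => S.clairaut z.1 z.2 :=
  (S.B_smooth.comp contDiff_snd).sub
    ((S.a_smooth.comp contDiff_snd).mul (contDiff_sin.comp contDiff_fst))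

theorem den_smooth : ContDiff ℝ ∞ fun z : ℝ × ℝ => S.den z.1 z.2 :=
  (S.ab_smooth.comp contDiff_snd).sub
    ((S.deriv_a_smooth.comp contDiff_snd).mul (contDiff_sin.comp contDiff_fst))

theorem clairaut_strictMono (θ : ℝ) : StrictMono (S.clairaut θ) :=
  strictMono_of_deriv_pos fun x => by
    rw [(S.hasDerivAt_clairaut θ x).deriv]; exact S.den_pos θ x

theorem clairaut_surjective (θ : ℝ) : Function.Surjective (S.clairaut θ) :=
  surjective_of_add_const S.P_pos
    (continuous_iff_continuousAt.2 fun x => (S.hasDerivAt_clairaut θ x).continuousAt)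
    (S.clairaut_add_one θ)

/-- The position `x` at angle `θ` on the orbit with Clairaut integral `c`. -/
def X (θ c : ℝ) : ℝ := Function.surjInv (S.clairaut_surjective θ) c

@[simp] theorem clairaut_X (θ c : ℝ) : S.clairaut θ (S.X θ c) = c :=
  Function.surjInv_eq (S.clairaut_surjective θ) c

theorem eq_X {θ x c : ℝ} (h : S.clairaut θ x = c) : x = S.X θ c :=
  (S.clairaut_strictMono θ).injective (by rw [h, S.clairaut_X])

theorem X_add_P (θ c : ℝ) : S.X θ (c + S.P) = S.X θ c + 1 :=
  (S.eq_X (by rw [S.clairaut_add_one, S.clairaut_X])).symm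

theorem X_add_two_pi (θ c : ℝ) : S.X (θ + 2 * π) c = S.X θ c :=
  by
  refine (S.eq_X (?_ : S.clairaut (θ + 2 * π) (S.X θ c) = c)).symm
  rw [clairaut, sin_add_two_pi]
  exact S.clairaut_X θ c

/-- `(θ, c) ↦ (θ, X θ c)` inverts `(θ, x) ↦ (θ, clairaut θ x)`, whose derivative is triangular with
diagonal entries `1` and `den > 0`. -/
theorem X_smooth : ContDiff ℝ ∞ fun z : ℝ × ℝ => S.X z.1 z.2 := by
  have hf : ContDiff ℝ ∞ fun z : ℝ × ℝ => (z.1, S.clairaut z.1 z.2) :=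
    contDiff_fst.prodMk S.clairaut_smooth
  have key := contDiff_of_rightInverse hf (g := fun z : ℝ × ℝ => (z.1, S.X z.1 z.2)) ?_ ?_ ?_
  · exact contDiff_snd.comp key
  · rintro ⟨θ, x⟩ ⟨θ', x'⟩ h
    obtain ⟨rfl, h⟩ := Prod.mk.inj h
    exact Prod.ext rfl ((S.clairaut_strictMono θ).injective h)
  · rintro ⟨θ, c⟩; exact Prod.ext rfl (S.clairaut_X θ c)
  · rintro ⟨θ, x⟩
    have hd1 : HasFDerivAt (fun z : ℝ × ℝ => S.clairaut z.1 z.2)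
        (fderiv ℝ (fun z : ℝ × ℝ => S.clairaut z.1 z.2) (θ, x)) (θ, x) :=
      (S.clairaut_smooth.differentiable (by simp) _).hasFDerivAt
    set f₂ := fderiv ℝ (fun z : ℝ × ℝ => S.clairaut z.1 z.2) (θ, x)
    have hfd := (hasFDerivAt_fst (𝕜 := ℝ) (p := (θ, x))).prodMk hd1
    have h2 : f₂ (0, 1) = S.den θ x :=
      ((hd1.comp_hasDerivAt x (f := fun x => (θ, x))
        ((hasDerivAt_const x θ).prodMk (hasDerivAt_id x))).unique
        (S.hasDerivAt_clairaut θ x))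
    have h3 : ∀ u v, f₂ (u, v) = u * f₂ (1, 0) + v * S.den θ x := fun u v => by
      rw [← h2, ← smul_eq_mul, ← smul_eq_mul, ← map_smul, ← map_smul, ← map_add]; simp
    have hinj : Function.Injective ((ContinuousLinearMap.fst ℝ ℝ ℝ).prod f₂) := by
      rw [injective_iff_map_eq_zero]
      rintro ⟨u, v⟩ h
      obtain ⟨h', h⟩ := Prod.mk.inj (show (u, f₂ (u, v)) = (0, 0) from h)
      obtain rfl : u = 0 := h'
      rw [h3] at h
      rw [zero_mul, zero_add] at h
      rw [(mul_eq_zero.1 h).resolve_right (S.den_pos θ x).ne']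
      rfl
    refine ⟨(LinearEquiv.ofInjectiveEndo _ hinj).toContinuousLinearEquiv, ?_⟩
    have : ((LinearEquiv.ofInjectiveEndo _ hinj).toContinuousLinearEquiv : ℝ × ℝ →L[ℝ] ℝ × ℝ) =
        (ContinuousLinearMap.fst ℝ ℝ ℝ).prod f₂ := ContinuousLinearMap.ext fun _ => rfl
    rw [this]
    exact hfd

/-- The derivative of time with respect to the angle. -/
def dt (θ c : ℝ) : ℝ := S.a (S.X θ c) / S.den θ (S.X θ c)

/-- The derivative of `y` with respect to the angle. -/
def dy (θ c : ℝ) : ℝ := sin θ / S.den θ (S.X θ c)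

theorem comp_X_smooth {f : ℝ → ℝ} (hf : ContDiff ℝ ∞ f) :
    ContDiff ℝ ∞ fun z : ℝ × ℝ => f (S.X z.1 z.2) := hf.comp S.X_smooth

theorem den_X_smooth : ContDiff ℝ ∞ fun z : ℝ × ℝ => S.den z.1 (S.X z.1 z.2) :=
  S.den_smooth.comp (contDiff_fst.prodMk S.X_smooth)

theorem dt_smooth : ContDiff ℝ ∞ fun z : ℝ × ℝ => S.dt z.1 z.2 :=
  (S.comp_X_smooth S.a_smooth).div S.den_X_smooth fun _ => (S.den_pos _ _).ne'

theorem dy_smooth : ContDiff ℝ ∞ fun z : ℝ × ℝ => S.dy z.1 z.2 :=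
  (contDiff_sin.comp contDiff_fst).div S.den_X_smooth fun _ => (S.den_pos _ _).ne'

theorem dt_pos (θ c : ℝ) : 0 < S.dt θ c := div_pos (S.a_pos _) (S.den_pos _ _)

theorem dt_continuous (c : ℝ) : Continuous fun θ => S.dt θ c :=
  (contDiff_slice_left S.dt_smooth c).continuous

theorem dy_continuous (c : ℝ) : Continuous fun θ => S.dy θ c :=
  (contDiff_slice_left S.dy_smooth c).continuous

theorem den_add_two_pi (θ x : ℝ) : S.den (θ + 2 * π) x = S.den θ x := by simp [den]

theorem den_add_one (θ x : ℝ) : S.den θ (x + 1) = S.den θ x := by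
  simp [den, S.a_periodic x, S.b_periodic x, S.deriv_a_periodic x]

theorem dt_periodic (c : ℝ) : Function.Periodic (fun θ => S.dt θ c) (2 * π) := fun θ => by
  simp only [dt, S.X_add_two_pi, S.den_add_two_pi]

theorem dy_periodic (c : ℝ) : Function.Periodic (fun θ => S.dy θ c) (2 * π) := fun θ => by
  simp only [dy, S.X_add_two_pi, S.den_add_two_pi, sin_add_two_pi]

theorem dt_add_P (θ c : ℝ) : S.dt θ (c + S.P) = S.dt θ c := by
  simp only [dt, S.X_add_P, S.den_add_one, S.a_periodic _]

theorem dy_add_P (θ c : ℝ) : S.dy θ (c + S.P) = S.dy θ c := by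
  simp only [dy, S.X_add_P, S.den_add_one]

theorem hasDerivAt_X_right (θ c : ℝ) :
    HasDerivAt (S.X θ) (1 / S.den θ (S.X θ c)) c := by
  have hd : HasDerivAt (S.X θ) (deriv (S.X θ) c) c :=
    ((contDiff_slice_right S.X_smooth θ).differentiable
      (by simp) c).hasDerivAt
  have h1 := (S.hasDerivAt_clairaut θ (S.X θ c)).comp c hd
  have h2 : S.clairaut θ ∘ S.X θ = id := funext fun c => S.clairaut_X θ c
  rw [h2] at h1
  have h3 := h1.unique (hasDerivAt_id c)
  rwa [eq_div_of_mul_eq (S.den_pos θ _).ne' ((mul_comm _ _).trans h3)] at hd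

/-- Implicit differentiation of `clairaut θ (X θ c) = c` in `θ`; this is `x' = cos θ` with the angle
as parameter. -/
theorem hasDerivAt_X_left (θ c : ℝ) :
    HasDerivAt (fun θ => S.X θ c) (cos θ * S.dt θ c) θ := by
  have hd : HasDerivAt (fun θ => S.X θ c) (deriv (fun θ => S.X θ c) θ) θ :=
    ((contDiff_slice_left S.X_smooth c).differentiable
      (by simp) θ).hasDerivAt
  have h1 := ((S.hasDerivAt_B (S.X θ c)).comp θ hd).sub
    (((S.hasDerivAt_a (S.X θ c)).comp θ hd).mul (hasDerivAt_sin θ))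
  have h2 : (S.B ∘ fun θ => S.X θ c) - (S.a ∘ fun θ => S.X θ c) * sin = fun _ => c :=
    funext fun θ => S.clairaut_X θ c
  rw [h2] at h1
  have h3 := h1.unique (hasDerivAt_const θ c)
  have h4 : deriv (fun θ => S.X θ c) θ = cos θ * S.dt θ c := by
    rw [dt, mul_div_assoc', eq_div_iff (S.den_pos θ _).ne', den]
    simp only [Function.comp] at h3
    linear_combination h3
  rwa [h4] at hd

/-! ### Displacement, time and magnetic length over a turn. -/

/-- The displacement in the direction `y` along an orbit from angle `0` to angle `θ`. -/
def Y (θ c : ℝ) : ℝ := ∫ φ in (0 : ℝ)..θ, S.dy φ c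

/-- The time along an orbit from angle `0` to angle `θ`. -/
def τ (θ c : ℝ) : ℝ := ∫ φ in (0 : ℝ)..θ, S.dt φ c

/-- The displacement in the direction `y` after a full turn. -/
def W (c : ℝ) : ℝ := S.Y (2 * π) c

/-- The magnetic length of a full turn. -/
def F (c : ℝ) : ℝ := ∫ φ in (0 : ℝ)..2 * π, cos φ ^ 2 * S.dt φ c

theorem Y_smooth : ContDiff ℝ ∞ fun z : ℝ × ℝ => S.Y z.1 z.2 :=
  contDiff_primitive (h := fun z => S.dy z.1 z.2) S.dy_smooth

theorem τ_smooth : ContDiff ℝ ∞ fun z : ℝ × ℝ => S.τ z.1 z.2 :=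
  contDiff_primitive (h := fun z => S.dt z.1 z.2) S.dt_smooth

theorem hasDerivAt_Y (θ c : ℝ) : HasDerivAt (fun θ => S.Y θ c) (S.dy θ c) θ :=
  intervalIntegral.integral_hasDerivAt_right ((S.dy_continuous c).intervalIntegrable _ _)
    ((S.dy_continuous c).stronglyMeasurableAtFilter _ _) (S.dy_continuous c).continuousAt

theorem hasDerivAt_τ (θ c : ℝ) : HasDerivAt (fun θ => S.τ θ c) (S.dt θ c) θ :=
  intervalIntegral.integral_hasDerivAt_right ((S.dt_continuous c).intervalIntegrable _ _)
    ((S.dt_continuous c).stronglyMeasurableAtFilter _ _) (S.dt_continuous c).continuousAt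

theorem Y_add_P (θ c : ℝ) : S.Y θ (c + S.P) = S.Y θ c := by simp only [Y, S.dy_add_P]

theorem primitive_add_period {f : ℝ → ℝ} {T : ℝ} (hf : Continuous f) (hp : Function.Periodic f T)
    (θ : ℝ) : ∫ φ in (0 : ℝ)..θ + T, f φ = (∫ φ in (0 : ℝ)..θ, f φ) + ∫ φ in (0 : ℝ)..T, f φ := by
  have h := hp.intervalIntegral_add_eq θ 0
  rw [zero_add] at h
  rw [← h, intervalIntegral.integral_add_adjacent_intervals] <;>
  exact hf.intervalIntegrable _ _

theorem Y_add_two_pi (θ c : ℝ) : S.Y (θ + 2 * π) c = S.Y θ c + S.W c :=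
  primitive_add_period (S.dy_continuous c) (S.dy_periodic c) θ

theorem τ_add_two_pi (θ c : ℝ) : S.τ (θ + 2 * π) c = S.τ θ c + S.τ (2 * π) c :=
  primitive_add_period (S.dt_continuous c) (S.dt_periodic c) θ

theorem F_add_P (c : ℝ) : S.F (c + S.P) = S.F c := by simp only [F, S.dt_add_P]

theorem W_continuous : Continuous S.W :=
  (contDiff_slice_right S.Y_smooth (2 * π)).continuous

/-- `cos φ * dt` is the `φ`-derivative of `X`, so this is an integration by parts; the boundary
terms cancel because `X` is `2π`-periodic in the angle. In this form only `X` depends on `c`. -/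
theorem F_eq_integral_X (c : ℝ) : S.F c = ∫ φ in (0 : ℝ)..2 * π, sin φ * S.X φ c := by
  have hX : Continuous fun θ => S.X θ c :=
    (contDiff_slice_left S.X_smooth c).continuous
  have h := intervalIntegral.integral_mul_deriv_eq_deriv_mul (a := 0) (b := 2 * π)
    (u := cos) (v := fun θ => S.X θ c) (fun θ _ => hasDerivAt_cos θ)
    (fun θ _ => S.hasDerivAt_X_left θ c)
    (continuous_sin.neg.intervalIntegrable _ _)
    ((continuous_cos.mul (S.dt_continuous c)).intervalIntegrable _ _)
  have h0 := S.X_add_two_pi 0 c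
  rw [zero_add] at h0
  simp only [h0, cos_two_pi, cos_zero, sub_self, zero_sub, neg_mul,
    intervalIntegral.integral_neg, neg_neg] at h
  rw [← h, F]
  congr 1; ext φ; ring

/-- Differentiating `sin φ * X φ c` in `c` gives `sin φ / den`, which is `dy`. Hence the critical
points of `F` are the Clairaut values whose orbits close up after one turn. -/
theorem hasDerivAt_F (c : ℝ) : HasDerivAt S.F (S.W c) c := by
  have hs : ContDiff ℝ 1 fun z : ℝ × ℝ => sin z.2 * S.X z.2 z.1 :=
    ((contDiff_sin.comp contDiff_snd).mul
      (S.X_smooth.comp (contDiff_snd.prodMk contDiff_fst))).of_le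
      (by simp)
  have h := (hasFDerivAt_intervalIntegral hs 0 (2 * π) c).hasDerivAt
  rw [funext S.F_eq_integral_X]
  convert! h using 1
  have hi : IntervalIntegrable (fun s => (fderiv ℝ (fun z : ℝ × ℝ => sin z.2 * S.X z.2 z.1)
      (c, s)).comp (ContinuousLinearMap.inl ℝ ℝ ℝ)) volume 0 (2 * π) :=
    Continuous.intervalIntegrable (((hs.continuous_fderiv (by simp)).comp
      (by fun_prop : Continuous fun s : ℝ => (c, s))).clm_comp continuous_const) _ _
  rw [ContinuousLinearMap.intervalIntegral_apply hi, W, Y]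
  refine intervalIntegral.integral_congr fun s _ => ?_
  have hd := ((hs.differentiable (by simp) (c, s)).hasFDerivAt.comp c
    (hasFDerivAt_prodMk_left c s)).hasDerivAt
  have hd' := (S.hasDerivAt_X_right s c).const_mul (sin s)
  rw [dy, div_eq_mul_one_div]
  exact hd'.unique hd

theorem F_continuous : Continuous S.F :=
  continuous_iff_continuousAt.2 fun c => (S.hasDerivAt_F c).continuousAt

/-! ### The mean value of `F` and its minimum. -/

/-- At fixed angle substitute `x = X φ c`, for which `dx = dc / den`: as `c` runs over a period `P`,
`x` runs over a period of `a`. The result does not depend on `φ`. -/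
theorem integral_dt (φ : ℝ) :
    ∫ c in (0 : ℝ)..S.P, S.dt φ c = ∫ x in (0 : ℝ)..1, S.a x := by
  have ha := S.a_smooth.continuous
  have hd : ∀ c, HasDerivAt (fun c => ∫ x in (0 : ℝ)..S.X φ c, S.a x) (S.dt φ c) c := fun c => by
    have h1 : HasDerivAt (fun u => ∫ x in (0 : ℝ)..u, S.a x) (S.a (S.X φ c)) (S.X φ c) :=
      intervalIntegral.integral_hasDerivAt_right (ha.intervalIntegrable _ _)
        (ha.stronglyMeasurableAtFilter _ _) ha.continuousAt
    rw [dt, div_eq_mul_one_div]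
    exact h1.comp c (S.hasDerivAt_X_right φ c)
  rw [intervalIntegral.integral_eq_sub_of_hasDerivAt (fun c _ => hd c)
    (Continuous.intervalIntegrable (contDiff_slice_right S.dt_smooth φ).continuous _ _)]
  have := S.X_add_P φ 0
  rw [zero_add] at this
  rw [this, primitive_add_period ha S.a_periodic]
  ring

theorem intervalIntegral_swap {f : ℝ → ℝ → ℝ} (hf : Continuous (Function.uncurry f))
    {p q r s : ℝ} (h : r ≤ s) :
    ∫ x in p..q, ∫ y in r..s, f x y = ∫ y in r..s, ∫ x in p..q, f x y := by
  simp only [intervalIntegral.integral_of_le h]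
  refine intervalIntegral_integral_swap ?_
  rw [Measure.prod_restrict]
  exact (hf.continuousOn.integrableOn_compact (isCompact_uIcc.prod isCompact_Icc)).mono_set
    (prod_mono uIoc_subset_uIcc Ioc_subset_Icc_self)

theorem integral_F : ∫ c in (0 : ℝ)..S.P, S.F c = π * ∫ x in (0 : ℝ)..1, S.a x := by
  have hdt : Continuous fun z : ℝ × ℝ => S.dt z.2 z.1 :=
    (contDiff_uncurry_comp S.dt_smooth contDiff_snd contDiff_fst).continuous
  have hc : Continuous fun z : ℝ × ℝ => cos z.2 ^ 2 * S.dt z.2 z.1 :=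
    Continuous.mul (by fun_prop) hdt
  simp only [F]
  rw [intervalIntegral_swap (f := fun c φ => cos φ ^ 2 * S.dt φ c) hc two_pi_pos.le]
  simp only [intervalIntegral.integral_const_mul, S.integral_dt]
  rw [intervalIntegral.integral_mul_const, integral_cos_sq]
  simp

/-- The mean value of `F`. -/
def mean : ℝ := π * (∫ x in (0 : ℝ)..1, S.a x) / S.P

theorem exists_isMinOn_F : ∃ c, ∀ c', S.F c ≤ S.F c' := by
  obtain ⟨c, -, hc⟩ := isCompact_Icc.exists_isMinOn (nonempty_Icc.2 S.P_pos.le)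
    S.F_continuous.continuousOn
  refine ⟨c, fun c' => ?_⟩
  have hp : Function.Periodic S.F S.P := S.F_add_P
  obtain ⟨y, hy, h⟩ := hp.exists_mem_Ico₀ S.P_pos c'
  rw [h]
  exact hc (Ico_subset_Icc_self hy)

theorem W_eq_zero_of_isMin {c : ℝ} (hc : ∀ c', S.F c ≤ S.F c') : S.W c = 0 :=
  (show IsLocalMin S.F c from Eventually.of_forall hc).hasDerivAt_eq_zero (S.hasDerivAt_F c)

theorem integral_F_sub (m : ℝ) :
    ∫ c in (0 : ℝ)..S.P, (S.F c - m) = S.P * (S.mean - m) := by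
  rw [intervalIntegral.integral_sub (S.F_continuous.intervalIntegrable _ _) (by simp), S.integral_F,
    mean]
  have := S.P_pos.ne'
  simp
  field_simp

theorem le_mean {m : ℝ} (hm : ∀ c, m ≤ S.F c) : m ≤ S.mean := by
  have h := S.integral_F_sub m
  have : 0 ≤ ∫ c in (0 : ℝ)..S.P, (S.F c - m) :=
    intervalIntegral.integral_nonneg S.P_pos.le fun c _ => sub_nonneg.2 (hm c)
  rw [h] at this
  exact sub_nonneg.1 (nonneg_of_mul_nonneg_right this S.P_pos)

/-- A continuous nonnegative function with zero integral over a period vanishes. -/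
theorem F_eq_mean_of_forall_le (hm : ∀ c, S.mean ≤ S.F c) (c : ℝ) : S.F c = S.mean := by
  have h := S.integral_F_sub S.mean
  have hp : Function.Periodic S.F S.P := S.F_add_P
  obtain ⟨y, hy, hc⟩ := hp.exists_mem_Ico₀ S.P_pos c
  rw [hc]
  by_contra hne
  have : 0 < ∫ c in (0 : ℝ)..S.P, (S.F c - S.mean) :=
    intervalIntegral.integral_pos S.P_pos
      (S.F_continuous.sub continuous_const).continuousOn (fun c _ => sub_nonneg.2 (hm c))
      ⟨y, Ico_subset_Icc_self hy, sub_pos.2 (lt_of_le_of_ne (hm y) (Ne.symm hne))⟩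
  simp [h] at this

theorem W_eq_zero_of_F_const {m : ℝ} (h : ∀ c, S.F c = m) (c : ℝ) : S.W c = 0 := by
  have := S.hasDerivAt_F c
  rw [funext h] at this
  exact this.unique (hasDerivAt_const c m)

theorem F_eq_mean_of_W_eq_zero (h : ∀ c, S.W c = 0) (c : ℝ) : S.F c = S.mean := by
  have hc : ∀ c', S.F c' = S.F c := fun c' =>
    is_const_of_deriv_eq_zero (fun c => (S.hasDerivAt_F c).differentiableAt)
      (fun c => (S.hasDerivAt_F c).deriv.trans (h c)) c' c
  have h := S.integral_F_sub (S.F c)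
  simp only [hc, sub_self, intervalIntegral.integral_zero] at h
  have := (mul_eq_zero.1 h.symm).resolve_left S.P_pos.ne'
  linarith

/-- If the displacement after a turn always is a rational multiple of `L`, it vanishes. -/
theorem W_eq_zero_of_rational {L : ℝ} (h : ∀ c, ∃ q : ℚ, S.W c = q * L) (c : ℝ) : S.W c = 0 := by
  obtain ⟨c₀, hc₀⟩ := S.exists_isMinOn_F
  -- The range of the continuous function `W` is connected and countable, hence a single point; that
  -- point is `0` because `W = F'` vanishes where `F` is minimal.
  have hcount : (range S.W).Countable := by
    refine (countable_range fun q : ℚ => (q : ℝ) * L).mono ?_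
    rintro _ ⟨c, rfl⟩
    obtain ⟨q, hq⟩ := h c
    exact ⟨q, hq.symm⟩
  have hs := hcount.isTotallyDisconnected _ subset_rfl (isPreconnected_range S.W_continuous)
  rw [← S.W_eq_zero_of_isMin hc₀]
  exact hs ⟨c, rfl⟩ ⟨c₀, rfl⟩

end Profile

/-- The lift to the line of a rotationally symmetric magnetic system. -/
def profile (a b : AddCircle (1 : ℝ) → ℝ) (ha : ContDiff ℝ ∞ fun x : ℝ => a x)
    (hb : ContDiff ℝ ∞ fun x : ℝ => b x) (hpos : ∀ x, 0 < a x)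
    (hab : ∀ x : ℝ, |deriv (fun t : ℝ => a t) x| < a x * b x) : Profile where
  a x := a x
  b x := b x
  a_smooth := ha
  b_smooth := hb
  a_periodic x := by simp
  b_periodic x := by simp
  a_pos x := hpos x
  abs_deriv_lt := hab

/-! ### Levi-Civita connection and geodesic curvature of the metric `dx² + a² dy²`. -/

section RotSym

variable {L : ℝ} {a b : AddCircle (1 : ℝ) → ℝ} {ha : ContDiff ℝ ∞ fun x : ℝ => a x}
  {hb : ContDiff ℝ ∞ fun x : ℝ => b x} {hpos : ∀ x, 0 < a x}

theorem rotSym_metric (q : Torus L) (u v : Fin 2 → ℝ) :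
    (rotSym L a b ha hb hpos).metric q u v = u 0 * v 0 + a q.1 ^ 2 * u 1 * v 1 := by
  simp [MagneticSystem.metric, rotSym, Fin.sum_univ_two]

theorem rotSym_areaDensity (q : Torus L) :
    (rotSym L a b ha hb hpos).areaDensity q = a q.1 := by
  simp [MagneticSystem.areaDensity, rotSym, Matrix.det_diagonal, Real.sqrt_sq (hpos q.1).le]

theorem rotSym_perp (q : Torus L) (v : Fin 2 → ℝ) :
    (rotSym L a b ha hb hpos).perp q v = ![-(a q.1 * v 1), v 0 / a q.1] := by
  have := (hpos q.1).ne'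
  rw [MagneticSystem.perp, rotSym_areaDensity]
  ext i
  fin_cases i <;> simp [rotSym] <;> field_simp

theorem rotSym_dg (l i j : Fin 2) (p : Fin 2 → ℝ) :
    (rotSym L a b ha hb hpos).dg l i j p =
      if l = 0 ∧ i = 1 ∧ j = 1 then 2 * a (p 0 : AddCircle (1 : ℝ)) *
        deriv (fun t : ℝ => a t) (p 0) else 0 := by
  have h : HasFDerivAt (fun z : Fin 2 → ℝ => a (z 0 : AddCircle (1 : ℝ)) ^ 2)
      ((2 * a (p 0 : AddCircle (1 : ℝ)) * deriv (fun t : ℝ => a t) (p 0)) •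
        (ContinuousLinearMap.proj (R := ℝ) (φ := fun _ : Fin 2 => ℝ) 0)) p := by
    have h1 : HasDerivAt (fun t : ℝ => a t ^ 2) (2 * a (p 0 : AddCircle (1 : ℝ)) *
        deriv (fun t : ℝ => a t) (p 0)) (p 0) := by
      have := ((ha.differentiable (by simp) (p 0)).hasDerivAt).pow 2
      simp only [Nat.cast_ofNat, Nat.add_one_sub_one, pow_one] at this
      exact this
    exact h1.comp_hasFDerivAt p (hasFDerivAt_apply (𝕜 := ℝ) (0 : Fin 2) p)
  unfold MagneticSystem.dg
  fin_cases i <;> fin_cases j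
  · simp [rotSym]
  · simp [rotSym]
  · simp [rotSym]
  · simp only [rotSym, proj, Fin.mk_one, Matrix.diagonal_apply_eq, Matrix.cons_val_one,
      Matrix.cons_val_fin_one]
    rw [h.fderiv]
    fin_cases l <;> simp

theorem rotSym_christoffel (k i j : Fin 2) (p : Fin 2 → ℝ) :
    (rotSym L a b ha hb hpos).christoffel k i j p =
      if k = 0 then
        (if i = 1 ∧ j = 1 then -(a (p 0 : AddCircle (1 : ℝ)) * deriv (fun t : ℝ => a t) (p 0))
          else 0)
      else
        (if i = j then 0 else deriv (fun t : ℝ => a t) (p 0) / a (p 0 : AddCircle (1 : ℝ))) := by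
  have hp := (hpos (p 0 : AddCircle (1 : ℝ))).ne'
  have hinv : ((rotSym L a b ha hb hpos).g (proj L p))⁻¹ =
      Matrix.diagonal ![1, (a (p 0 : AddCircle (1 : ℝ)) ^ 2)⁻¹] := by
    refine Matrix.inv_eq_right_inv ?_
    rw [rotSym, Matrix.diagonal_mul_diagonal, ← Matrix.diagonal_one]
    congr 1
    ext i
    fin_cases i <;> simp [proj, hp]
  simp only [MagneticSystem.christoffel, hinv, rotSym_dg, Fin.sum_univ_two]
  fin_cases k <;> fin_cases i <;> fin_cases j <;> simp <;> field_simp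

theorem rotSym_geodesicCurvature (c : ℝ → Fin 2 → ℝ) (t : ℝ) :
    (rotSym L a b ha hb hpos).geodesicCurvature c t =
      -(deriv (deriv c) t 0 - a (c t 0 : AddCircle (1 : ℝ)) * deriv (fun t : ℝ => a t) (c t 0) *
        deriv c t 1 ^ 2) * (a (c t 0 : AddCircle (1 : ℝ)) * deriv c t 1) +
      (a (c t 0 : AddCircle (1 : ℝ)) * deriv (deriv c) t 1 +
        2 * deriv (fun t : ℝ => a t) (c t 0) * deriv c t 0 * deriv c t 1) * deriv c t 0 := by
  have hp := (hpos (c t 0 : AddCircle (1 : ℝ))).ne'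
  simp only [MagneticSystem.geodesicCurvature, rotSym_metric, rotSym_perp,
    MagneticSystem.acceleration, rotSym_christoffel, Fin.sum_univ_two]
  simp [proj]
  field_simp
  ring

end RotSym

/-! ### Geodesics as solutions of the first-order system for `(x, y, θ)`. -/

theorem exists_cos_sin {u w : ℝ} (h : u ^ 2 + w ^ 2 = 1) : ∃ θ, cos θ = u ∧ sin θ = w := by
  have hz : ‖(⟨u, w⟩ : ℂ)‖ = 1 := by
    rw [Complex.norm_def, Complex.normSq_mk, ← sq, ← sq, h, sqrt_one]
  have h0 : (⟨u, w⟩ : ℂ) ≠ 0 := norm_ne_zero_iff.1 (by rw [hz]; exact one_ne_zero)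
  exact ⟨Complex.arg ⟨u, w⟩, by rw [Complex.cos_arg h0, hz, div_one], by
    rw [Complex.sin_arg, hz, div_one]⟩

namespace Profile

variable (S : Profile)

/-- The curve `c` has unit speed, makes the angle `θ` with `∂_x`, and satisfies the equation of
magnetic geodesics. -/
def IsOrbit (c : ℝ → Fin 2 → ℝ) (θ : ℝ → ℝ) : Prop :=
  ∀ t, HasDerivAt c ![cos (θ t), sin (θ t) / S.a (c t 0)] t ∧
    HasDerivAt θ (S.den (θ t) (c t 0) / S.a (c t 0)) t

/-- The `(g, b)`-geodesics in terms of the angle which they make with `∂_x`. -/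
theorem exists_isOrbit {c : ℝ → Fin 2 → ℝ} (hc : ContDiff ℝ ∞ c)
    (h1 : ∀ t, deriv c t 0 ^ 2 + S.a (c t 0) ^ 2 * deriv c t 1 ^ 2 = 1)
    (h2 : ∀ t, -(deriv (deriv c) t 0 - S.a (c t 0) * deriv S.a (c t 0) * deriv c t 1 ^ 2) *
        (S.a (c t 0) * deriv c t 1) + (S.a (c t 0) * deriv (deriv c) t 1 +
        2 * deriv S.a (c t 0) * deriv c t 0 * deriv c t 1) * deriv c t 0 = S.b (c t 0)) :
    ∃ θ, S.IsOrbit c θ := by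
  have hc' : ContDiff ℝ ∞ (deriv c) := ((contDiff_infty_iff_deriv (𝕜 := ℝ)).1 hc).2
  have hd : ∀ t i, HasDerivAt (fun t => c t i) (deriv c t i) t := fun t i =>
    (hasDerivAt_pi.1 (hc.differentiable (by simp) t).hasDerivAt) i
  have hd2 : ∀ t i, HasDerivAt (fun t => deriv c t i) (deriv (deriv c) t i) t := fun t i =>
    (hasDerivAt_pi.1 (hc'.differentiable (by simp) t).hasDerivAt) i
  -- `u` and `w` are the components of the velocity in the orthonormal frame `∂_x`, `a⁻¹ ∂_y`, and
  -- `κ` is the rate at which the velocity turns in this frame: the curvature corrected by the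
  -- connection term.
  set u : ℝ → ℝ := fun t => deriv c t 0 with hu
  set w : ℝ → ℝ := fun t => S.a (c t 0) * deriv c t 1 with hw
  set κ : ℝ → ℝ := fun t => S.b (c t 0) - deriv S.a (c t 0) * deriv c t 1 with hκ
  have hda : ∀ t, HasDerivAt (fun t => S.a (c t 0)) (deriv S.a (c t 0) * deriv c t 0) t :=
    fun t => (S.hasDerivAt_a (c t 0)).comp t (hd t 0)
  have hdw : ∀ t, HasDerivAt w (deriv S.a (c t 0) * deriv c t 0 * deriv c t 1 +
      S.a (c t 0) * deriv (deriv c) t 1) t := fun t => (hda t).mul (hd2 t 1)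
  have huw : ∀ t, u t ^ 2 + w t ^ 2 = 1 := fun t => by rw [← h1 t]; simp only [hu, hw]; ring
  have horth : ∀ t, u t * deriv (deriv c) t 0 + w t * (deriv S.a (c t 0) * deriv c t 0 *
      deriv c t 1 + S.a (c t 0) * deriv (deriv c) t 1) = 0 := fun t => by
    have h := ((hd2 t 0).pow 2).add ((hdw t).pow 2)
    have h' : (fun t => deriv c t 0) ^ 2 + w ^ 2 = fun _ => (1 : ℝ) := funext huw
    rw [h'] at h
    have := h.unique (hasDerivAt_const t 1)
    simp only [Nat.cast_ofNat, Nat.add_one_sub_one, pow_one] at this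
    linear_combination this / 2
  have hrot : ∀ t, u t * (deriv S.a (c t 0) * deriv c t 0 * deriv c t 1 +
      S.a (c t 0) * deriv (deriv c) t 1) - w t * deriv (deriv c) t 0 = κ t := fun t => by
    simp only [hu, hw, hκ]
    linear_combination h2 t - deriv S.a (c t 0) * deriv c t 1 * h1 t
  have hu' : ∀ t, HasDerivAt u (-(w t * κ t)) t := fun t => by
    convert! hd2 t 0 using 1
    linear_combination w t * hrot t - u t * horth t + deriv (deriv c) t 0 * huw t
  have hw' : ∀ t, HasDerivAt w (u t * κ t) t := fun t => by
    convert! hdw t using 1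
    linear_combination -u t * hrot t - w t * horth t + (deriv S.a (c t 0) * deriv c t 0 *
      deriv c t 1 + S.a (c t 0) * deriv (deriv c) t 1) * huw t
  have hκc : Continuous κ := by
    have h0 : Continuous fun t => c t 0 := (continuous_apply 0).comp hc.continuous
    have h1 : Continuous fun t => deriv c t 1 := (continuous_apply 1).comp hc'.continuous
    exact (S.b_smooth.continuous.comp h0).sub ((S.deriv_a_smooth.continuous.comp h0).mul h1)
  obtain ⟨θ₀, hcos, hsin⟩ := exists_cos_sin (huw 0)
  set θ : ℝ → ℝ := fun t => θ₀ + ∫ s in (0 : ℝ)..t, κ s with hθ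
  have hθ' : ∀ t, HasDerivAt θ (κ t) t := fun t =>
    (intervalIntegral.integral_hasDerivAt_right (hκc.intervalIntegrable _ _)
      (hκc.stronglyMeasurableAtFilter _ _) hκc.continuousAt).const_add θ₀
  -- `(u, w)` and `(cos θ, sin θ)` are unit vectors turning at the same rate `κ` and equal at time
  -- `0`, so their scalar product stays `1` and they coincide. Defining `θ` as a primitive of `κ`
  -- avoids choosing branches of the argument.
  have hp : ∀ t, u t * cos (θ t) + w t * sin (θ t) = 1 := by
    have hp' : ∀ t, HasDerivAt (fun t => u t * cos (θ t) + w t * sin (θ t)) 0 t := fun t => by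
      convert! ((hu' t).mul (hθ' t).cos).add ((hw' t).mul (hθ' t).sin) using 1
      ring
    intro t
    have h := is_const_of_deriv_eq_zero (fun t => (hp' t).differentiableAt)
      (fun t => (hp' t).deriv) t 0
    have hθ0 : θ 0 = θ₀ := by simp [hθ]
    rw [h, hθ0, hcos, hsin, ← huw 0]; ring
  have hcs : ∀ t, u t = cos (θ t) ∧ w t = sin (θ t) := fun t => by
    have e := sin_sq_add_cos_sq (θ t)
    have : (u t - cos (θ t)) ^ 2 + (w t - sin (θ t)) ^ 2 = 0 := by
      linear_combination e + huw t - 2 * hp t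
    constructor <;> nlinarith [sq_nonneg (u t - cos (θ t)), sq_nonneg (w t - sin (θ t))]
  have ha := fun t => (S.a_pos (c t 0)).ne'
  refine ⟨θ, fun t => ⟨?_, ?_⟩⟩
  · rw [hasDerivAt_pi]
    intro i
    convert! hd t i using 1
    fin_cases i
    · exact (hcs t).1.symm
    · simp [← (hcs t).2, hw, ha]
  · convert! hθ' t using 1
    simp only [den, ← (hcs t).2, hw, hκ]
    have := ha t
    field_simp

theorem hasDerivAt_zero {c : ℝ → Fin 2 → ℝ} {v : Fin 2 → ℝ} {t : ℝ} (h : HasDerivAt c v t) :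
    HasDerivAt (fun t => c t 0) (v 0) t := hasDerivAt_pi.1 h 0

theorem hasDerivAt_one {c : ℝ → Fin 2 → ℝ} {v : Fin 2 → ℝ} {t : ℝ} (h : HasDerivAt c v t) :
    HasDerivAt (fun t => c t 1) (v 1) t := hasDerivAt_pi.1 h 1

namespace IsOrbit

variable {S} {c : ℝ → Fin 2 → ℝ} {θ : ℝ → ℝ} (h : S.IsOrbit c θ)
include h

theorem deriv_eq (t : ℝ) : deriv c t = ![cos (θ t), sin (θ t) / S.a (c t 0)] := (h t).1.deriv

theorem hasDerivAt_x (t : ℝ) : HasDerivAt (fun t => c t 0) (cos (θ t)) t := hasDerivAt_zero (h t).1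

theorem hasDerivAt_y (t : ℝ) : HasDerivAt (fun t => c t 1) (sin (θ t) / S.a (c t 0)) t :=
  hasDerivAt_one (h t).1

theorem strictMono : StrictMono θ := strictMono_of_deriv_pos fun t => by
  rw [(h t).2.deriv]; exact div_pos (S.den_pos _ _) (S.a_pos _)

theorem continuous_angle : Continuous θ :=
  continuous_iff_continuousAt.2 fun t => (h t).2.continuousAt

/-- Clairaut's first integral. -/
theorem clairaut_eq (t s : ℝ) : S.clairaut (θ t) (c t 0) = S.clairaut (θ s) (c s 0) := by
  have hd : ∀ t, HasDerivAt (fun t => S.clairaut (θ t) (c t 0)) 0 t := fun t => by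
    have h1 := ((S.hasDerivAt_B (c t 0)).comp t (h.hasDerivAt_x t)).sub
      (((S.hasDerivAt_a (c t 0)).comp t (h.hasDerivAt_x t)).mul (h t).2.sin)
    convert! h1 using 1
    have := (S.a_pos (c t 0)).ne'
    simp only [den, Function.comp]
    field_simp
    ring
  exact is_const_of_deriv_eq_zero (fun t => (hd t).differentiableAt) (fun t => (hd t).deriv) t s

theorem x_eq (t : ℝ) : c t 0 = S.X (θ t) (S.clairaut (θ 0) (c 0 0)) := S.eq_X (h.clairaut_eq t 0)

theorem angle_deriv_eq (t : ℝ) :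
    HasDerivAt θ (S.dt (θ t) (S.clairaut (θ 0) (c 0 0)))⁻¹ t := by
  rw [dt, inv_div, ← h.x_eq]; exact (h t).2

/-- Since `θ' = 1 / dt`, the chain rule gives `Y ∘ θ` the derivative `dy / dt = sin θ / a`, the same
as that of `y`. -/
theorem y_eq (t s : ℝ) : c t 1 - c s 1 =
    S.Y (θ t) (S.clairaut (θ 0) (c 0 0)) - S.Y (θ s) (S.clairaut (θ 0) (c 0 0)) := by
  have hd : ∀ t, HasDerivAt (fun t => c t 1 - S.Y (θ t) (S.clairaut (θ 0) (c 0 0))) 0 t :=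
    fun t => by
      have h1 := (h.hasDerivAt_y t).sub
        ((S.hasDerivAt_Y (θ t) (S.clairaut (θ 0) (c 0 0))).comp t (h t).2)
      convert! h1 using 1
      have := (S.a_pos (c t 0)).ne'
      have := (S.den_pos (θ t) (c t 0)).ne'
      rw [dy, ← h.x_eq]
      field_simp
      ring
  linarith [is_const_of_deriv_eq_zero (fun t => (hd t).differentiableAt)
    (fun t => (hd t).deriv) t s]

end IsOrbit

/-! ### Construction of the orbit with given initial data. -/

theorem τ_continuous (k : ℝ) : Continuous fun θ => S.τ θ k :=
  (contDiff_slice_left S.τ_smooth k).continuous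

theorem τ_strictMono (k : ℝ) : StrictMono fun θ => S.τ θ k := strictMono_of_deriv_pos fun θ => by
  rw [(S.hasDerivAt_τ θ k).deriv]; exact S.dt_pos θ k

theorem τ_zero (k : ℝ) : S.τ 0 k = 0 := by simp [τ]

theorem τ_two_pi_pos (k : ℝ) : 0 < S.τ (2 * π) k := by
  rw [← S.τ_zero k]; exact S.τ_strictMono k two_pi_pos

theorem τ_surjective (k : ℝ) : Function.Surjective fun θ => S.τ θ k :=
  surjective_of_add_const (S.τ_two_pi_pos k) (S.τ_continuous k) fun θ => S.τ_add_two_pi θ k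

/-- The time along an orbit as an order isomorphism. -/
def τIso (k : ℝ) : ℝ ≃o ℝ := (S.τ_strictMono k).orderIsoOfSurjective _ (S.τ_surjective k)

@[simp] theorem τIso_apply (k θ : ℝ) : S.τIso k θ = S.τ θ k := rfl

theorem τIso_symm_smooth (k : ℝ) : ContDiff ℝ ∞ (S.τIso k).symm := by
  refine contDiff_of_rightInverse (contDiff_slice_left S.τ_smooth k) (S.τ_strictMono k).injective
    (fun t => (S.τIso k).apply_symm_apply t) fun θ => ?_
  exact ⟨ContinuousLinearEquiv.unitsEquivAut ℝ (Units.mk0 _ (S.dt_pos θ k).ne'),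
    (S.hasDerivAt_τ θ k).hasFDerivAt.congr_fderiv (by ext; simp)⟩

theorem hasDerivAt_τIso_symm (k t : ℝ) :
    HasDerivAt (S.τIso k).symm (S.dt ((S.τIso k).symm t) k)⁻¹ t :=
  HasDerivAt.of_local_left_inverse (S.τIso_symm_smooth k).continuous.continuousAt
    (S.hasDerivAt_τ _ k) (S.dt_pos _ k).ne'
    (Eventually.of_forall fun t => (S.τIso k).apply_symm_apply t)

/-- The angle at time `t` of the orbit with Clairaut integral `k` which starts at angle `θ₀`. -/
def angle (k θ₀ t : ℝ) : ℝ := (S.τIso k).symm (t + S.τ θ₀ k)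

/-- The orbit with Clairaut integral `k` which starts at angle `θ₀` and height `y₀`. -/
def orbit (k θ₀ y₀ t : ℝ) : Fin 2 → ℝ :=
  ![S.X (S.angle k θ₀ t) k, y₀ + (S.Y (S.angle k θ₀ t) k - S.Y θ₀ k)]

@[simp] theorem angle_zero (k θ₀ : ℝ) : S.angle k θ₀ 0 = θ₀ := by
  rw [angle, zero_add, ← τIso_apply, OrderIso.symm_apply_apply]

theorem angle_smooth (k θ₀ : ℝ) : ContDiff ℝ ∞ (S.angle k θ₀) :=
  (S.τIso_symm_smooth k).comp (contDiff_id.add contDiff_const)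

theorem orbit_smooth (k θ₀ y₀ : ℝ) : ContDiff ℝ ∞ (S.orbit k θ₀ y₀) := by
  rw [contDiff_pi]
  intro i
  fin_cases i
  · exact (contDiff_slice_left S.X_smooth k).comp (S.angle_smooth k θ₀)
  · exact contDiff_const.add
      (((contDiff_slice_left S.Y_smooth k).comp (S.angle_smooth k θ₀)).sub contDiff_const)

theorem isOrbit_orbit (k θ₀ y₀ : ℝ) : S.IsOrbit (S.orbit k θ₀ y₀) (S.angle k θ₀) := by
  intro t
  have hθ : HasDerivAt (S.angle k θ₀) (S.dt (S.angle k θ₀ t) k)⁻¹ t := by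
    have h1 := (S.hasDerivAt_τIso_symm k (t + S.τ θ₀ k)).comp t
      ((hasDerivAt_id t).add_const (S.τ θ₀ k))
    rwa [mul_one] at h1
  have hdt := (S.dt_pos (S.angle k θ₀ t) k).ne'
  have ha := (S.a_pos (S.X (S.angle k θ₀ t) k)).ne'
  have hden := (S.den_pos (S.angle k θ₀ t) (S.X (S.angle k θ₀ t) k)).ne'
  refine ⟨hasDerivAt_pi.2 fun i => ?_, ?_⟩
  · fin_cases i
    · have h1 := (S.hasDerivAt_X_left (S.angle k θ₀ t) k).comp t hθ
      rw [mul_assoc, mul_inv_cancel₀ hdt, mul_one] at h1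
      exact h1
    · have h1 := (((S.hasDerivAt_Y (S.angle k θ₀ t) k).comp t hθ).sub_const (S.Y θ₀ k)).const_add y₀
      convert! h1 using 1
      simp only [orbit, dy, dt]
      simp
      field_simp
  · convert! hθ using 1
    simp [orbit, dt]

end Profile

section RotSym

variable {L : ℝ} {a b : AddCircle (1 : ℝ) → ℝ} {ha : ContDiff ℝ ∞ fun x : ℝ => a x}
  {hb : ContDiff ℝ ∞ fun x : ℝ => b x} {hpos : ∀ x, 0 < a x}
  (hab : ∀ x : ℝ, |deriv (fun t : ℝ => a t) x| < a x * b x)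

theorem isGeodesic_iff {c : ℝ → Fin 2 → ℝ} :
    (rotSym L a b ha hb hpos).IsGeodesic c ↔
      ContDiff ℝ ∞ c ∧ ∃ θ, (profile a b ha hb hpos hab).IsOrbit c θ := by
  constructor
  · rintro ⟨hc, h1, h2⟩
    refine ⟨hc, (profile a b ha hb hpos hab).exists_isOrbit hc (fun t => ?_) fun t => ?_⟩
    · rw [← h1 t, rotSym_metric]
      simp only [profile, proj]
      ring
    · exact (rotSym_geodesicCurvature c t).symm.trans (h2 t)
  · rintro ⟨hc, θ, h⟩
    have hd := fun t => h.deriv_eq t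
    have ha0 := fun t => (hpos (c t 0 : AddCircle (1 : ℝ))).ne'
    refine ⟨hc, fun t => ?_, fun t => ?_⟩
    · have := ha0 t
      rw [rotSym_metric, hd]
      simp [proj, profile]
      field_simp
      linarith [sin_sq_add_cos_sq (θ t)]
    · have hd0 : HasDerivAt (fun t => deriv c t 0) (-sin (θ t) *
          ((profile a b ha hb hpos hab).den (θ t) (c t 0) /
            (profile a b ha hb hpos hab).a (c t 0))) t := by
        rw [show (fun t => deriv c t 0) = fun t => cos (θ t) from funext fun t => by simp [hd]]
        exact (h t).2.cos
      have hda := ((profile a b ha hb hpos hab).hasDerivAt_a (c t 0)).comp t (h.hasDerivAt_x t)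
      have hd1 := (h t).2.sin.div hda (ha0 t)
      rw [show (fun t => sin (θ t)) / ((profile a b ha hb hpos hab).a ∘ fun t => c t 0) =
        fun t => deriv c t 1 from funext fun t => by simp [hd]] at hd1
      have hc' := ((contDiff_infty_iff_deriv (𝕜 := ℝ)).1 hc).2
      have hdd := (hc'.differentiable (by simp) t).hasDerivAt
      have e0 := (hasDerivAt_pi.1 hdd 0).unique hd0
      have e1 := (hasDerivAt_pi.1 hdd 1).unique hd1
      rw [rotSym_geodesicCurvature, e0, e1, hd]
      have := ha0 t
      have hcs := sin_sq_add_cos_sq (θ t)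
      simp only [Profile.den, profile, proj, rotSym, Matrix.cons_val_zero, Matrix.cons_val_one,
        Function.comp]
      generalize a (c t 0 : AddCircle (1 : ℝ)) = α at *
      generalize b (c t 0 : AddCircle (1 : ℝ)) = β at *
      generalize deriv (fun t : ℝ => a t) (c t 0) = α' at *
      have hcos : cos (θ t) ^ 2 = 1 - sin (θ t) ^ 2 := by linarith
      field_simp
      ring_nf
      rw [show cos (θ t) ^ 2 = 1 - sin (θ t) ^ 2 by linarith]
      ring

end RotSym

/-! ### Lifts to the plane, degree of loops, families of loops. -/

theorem coe_eq_coe_iff_exists_int {p x y : ℝ} :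
    (x : AddCircle p) = (y : AddCircle p) ↔ ∃ n : ℤ, x = y + n * p := by
  rw [← sub_eq_zero, ← AddCircle.coe_sub, AddCircle.coe_eq_zero_iff]
  simp only [zsmul_eq_mul]
  exact exists_congr fun n => ⟨fun h => by linarith, fun h => by linarith⟩

theorem proj_eq_iff {L : ℝ} {p q : Fin 2 → ℝ} :
    proj L p = proj L q ↔ (∃ m : ℤ, p 0 = q 0 + m) ∧ ∃ n : ℤ, p 1 = q 1 + n * L := by
  simp only [proj, Prod.mk.injEq, coe_eq_coe_iff_exists_int, mul_one]

theorem continuous_proj (L : ℝ) : Continuous (proj L) :=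
  (AddCircle.continuous_mk' (p := (1 : ℝ)) |>.comp (continuous_apply 0)).prodMk
    (AddCircle.continuous_mk' (p := L) |>.comp (continuous_apply 1))

/-- A continuous function on a connected space with values in a discrete subgroup of the line is
constant. -/
theorem eq_of_forall_exists_int {A : Type*} [TopologicalSpace A] [PreconnectedSpace A] {f : A → ℝ}
    {p : ℝ} (hf : Continuous f) (h : ∀ x, ∃ n : ℤ, f x = n * p) (x y : A) : f x = f y := by
  -- A countable connected subset of the line has at most one point.
  have hcount : (range f).Countable := by
    refine (countable_range fun n : ℤ => (n : ℝ) * p).mono ?_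
    rintro _ ⟨x, rfl⟩
    obtain ⟨n, hn⟩ := h x
    exact ⟨n, hn.symm⟩
  exact hcount.isTotallyDisconnected _ subset_rfl (isPreconnected_range hf) ⟨x, rfl⟩ ⟨y, rfl⟩

/-- Two lifts of the same map differ by a lattice vector, which by continuity is constant. -/
theorem sub_eq_sub_of_proj_eq {L : ℝ} {A : Type*} [TopologicalSpace A] [PreconnectedSpace A]
    {u v : A → Fin 2 → ℝ} (hu : Continuous u) (hv : Continuous v)
    (h : ∀ x, proj L (u x) = proj L (v x)) (x y : A) : u x - v x = u y - v y := by
  have h' := fun x => proj_eq_iff.1 (h x)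
  ext i
  fin_cases i
  · exact eq_of_forall_exists_int (f := fun x => u x 0 - v x 0) (p := 1) (by fun_prop)
      (fun x => let ⟨n, hn⟩ := (h' x).1; ⟨n, by rw [hn]; ring⟩) x y
  · exact eq_of_forall_exists_int (f := fun x => u x 1 - v x 1) (p := L) (by fun_prop)
      (fun x => let ⟨n, hn⟩ := (h' x).2; ⟨n, by rw [hn]; ring⟩) x y

/-- The degree of a loop of unit complex numbers is invariant under homotopies. -/
theorem angle_increment_eq {z : ℝ × ℝ → ℂ} (hz : Continuous z)
    (hper : ∀ r s, z (r, s + 1) = z (r, s)) {α β : ℝ → ℝ} (hα : Continuous α) (hβ : Continuous β)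
    (h0 : ∀ s, z (0, s) = Complex.exp (α s * Complex.I))
    (h1 : ∀ s, z (1, s) = Complex.exp (β s * Complex.I)) (hne : ∀ p, z p ≠ 0) :
    α 1 - α 0 = β 1 - β 0 := by
  have hsc : IsSimplyConnected (univ : Set (ℝ × ℝ)) :=
    (Homeomorph.Set.univ (ℝ × ℝ)).toHomotopyEquiv.simplyConnectedSpace
  -- The plane is simply connected, so `z` has a global continuous logarithm `f`, and `im f` is an
  -- angle function for the whole homotopy.
  obtain ⟨f, hf, hfz⟩ := Complex.exists_continuousOn_eqOn_exp_comp hsc isOpen_univ hz.continuousOn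
    (by rintro ⟨p, -, hp⟩; exact hne p hp)
  rw [← continuousOn_univ.symm.eq] at hf
  have hfz' : ∀ p, Complex.exp (f p) = z p := fun p => hfz (mem_univ p)
  have key : ∀ x y : ℂ, Complex.exp x = Complex.exp y →
      ∃ n : ℤ, x.im - y.im = n * (2 * π) := fun x y h => by
    obtain ⟨n, rfl⟩ := Complex.exp_eq_exp_iff_exists_int.1 h
    exact ⟨n, by simp⟩
  -- The increment of the angle over a period lies in `2πℤ`, so it is the same for all `r`. Next,
  -- `im f` is compared with `α` and `β` on the two ends, where it differs from them by constants.
  have e1 := eq_of_forall_exists_int (f := fun p : ℝ × ℝ => (f (p.1, p.2 + 1)).im - (f p).im)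
    (by fun_prop) (fun p => key _ _ (by rw [hfz', hfz', hper])) (0, 0) (1, 0)
  have e2 := eq_of_forall_exists_int (f := fun s : ℝ => (f (0, s)).im - α s)
    (by fun_prop) (fun s => by simpa using key _ _ ((hfz' _).trans (h0 s))) 0 1
  have e3 := eq_of_forall_exists_int (f := fun s : ℝ => (f (1, s)).im - β s)
    (by fun_prop) (fun s => by simpa using key _ _ ((hfz' _).trans (h1 s))) 0 1
  simp only [zero_add] at e1
  linarith

/-- A continuous family of loops parametrised by the line descends to the circle. -/
theorem exists_continuousMap_of_periodic {Y : Type*} [TopologicalSpace Y]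
    {f : unitInterval × ℝ → Y} (hf : Continuous f) (hper : ∀ r s, f (r, s + 1) = f (r, s)) :
    ∃ H : C(unitInterval × AddCircle (1 : ℝ), Y), ∀ r (s : ℝ),
      H (r, (s : AddCircle (1 : ℝ))) = f (r, s) := by
  have hp : ∀ r, Function.Periodic (fun s => f (r, s)) 1 := fun r s => hper r s
  have hq : IsOpenQuotientMap (Prod.map id ((↑) : ℝ → AddCircle (1 : ℝ)) :
      unitInterval × ℝ → unitInterval × AddCircle (1 : ℝ)) :=
    IsOpenQuotientMap.id.prodMap QuotientAddGroup.isOpenQuotientMap_mk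
  refine ⟨⟨fun z => (hp z.1).lift z.2, ?_⟩, fun r s => (hp r).lift_coe s⟩
  rw [← hq.continuous_comp_iff]
  exact hf

/-! ### Flux and magnetic length of geodesics in `Λ⁺`. -/

/-- Stokes' theorem for the pull-back of the area form `a b dx ∧ dy` to a square. -/
theorem Profile.integral_pullback (S : Profile) {U V : ℝ × ℝ → ℝ} (hU : ContDiff ℝ ∞ U)
    (hV : ContDiff ℝ ∞ V) :
    ∫ r in (0 : ℝ)..1, ∫ s in (0 : ℝ)..1, S.b (U (r, s)) * S.a (U (r, s)) *
      (fderiv ℝ U (r, s) (1, 0) * fderiv ℝ V (r, s) (0, 1) -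
        fderiv ℝ V (r, s) (1, 0) * fderiv ℝ U (r, s) (0, 1)) =
    ((-(∫ r in (0 : ℝ)..1, S.B (U (r, 1)) * fderiv ℝ V (r, 1) (1, 0)) +
      ∫ r in (0 : ℝ)..1, S.B (U (r, 0)) * fderiv ℝ V (r, 0) (1, 0)) +
      ∫ s in (0 : ℝ)..1, S.B (U (1, s)) * fderiv ℝ V (1, s) (0, 1)) -
      ∫ s in (0 : ℝ)..1, S.B (U (0, s)) * fderiv ℝ V (0, s) (0, 1) := by
  have hV' : ∀ v, ContDiff ℝ ∞ fun p => fderiv ℝ V p v := fun v =>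
    (hV.fderiv_right (by simp)).clm_apply contDiff_const
  have hB : ContDiff ℝ ∞ fun p => S.B (U p) := S.B_smooth.comp hU
  have hd : ∀ v p, HasFDerivAt (fun p => S.B (U p) * fderiv ℝ V p v)
      (S.B (U p) • (fderiv ℝ (fderiv ℝ V) p).flip v +
        fderiv ℝ V p v • ((S.a (U p) * S.b (U p)) • fderiv ℝ U p)) p := fun v p => by
    have h1 : HasFDerivAt (fun p => S.B (U p)) ((S.a (U p) * S.b (U p)) • fderiv ℝ U p) p :=
      (S.hasDerivAt_B (U p)).comp_hasFDerivAt p (hU.differentiable (by simp) p).hasFDerivAt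
    have h2 : HasFDerivAt (fun p => fderiv ℝ V p v) ((fderiv ℝ (fderiv ℝ V) p).flip v) p := by
      have h3 : ContDiff ℝ ∞ (fderiv ℝ V) := hV.fderiv_right (by simp)
      have := ((h3.differentiable (by simp) p).hasFDerivAt).clm_apply (hasFDerivAt_const v p)
      simpa using this
    exact h1.mul h2
  have hsymm : ∀ p v w, fderiv ℝ (fderiv ℝ V) p v w = fderiv ℝ (fderiv ℝ V) p w v := fun p v w =>
    (hV.contDiffAt.isSymmSndFDerivAt (by
      rw [minSmoothness_of_isRCLikeNormedField]
      exact WithTop.coe_le_coe.2 (le_top : (2 : ℕ∞) ≤ ⊤))).eq v w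
  -- The form is the differential of the pull-back of `B dy`. In the divergence of the field `(B
  -- V_s, -B V_r)` the mixed second derivatives of `V` cancel.
  have h := integral2_divergence_prod_of_hasFDerivAt
    (fun p => S.B (U p) * fderiv ℝ V p (0, 1)) (fun p => -(S.B (U p) * fderiv ℝ V p (1, 0)))
    _ _ 0 0 1 1 (hB.mul (hV' _)).continuous.continuousOn
    (hB.mul (hV' _)).neg.continuous.continuousOn
    (fun p _ => hd (0, 1) p) (fun p _ => (hd (1, 0) p).neg) ?_
  · simp only [intervalIntegral.integral_neg, sub_neg_eq_add] at h
    rw [← h]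
    refine intervalIntegral.integral_congr fun r _ => intervalIntegral.integral_congr fun s _ => ?_
    simp [hsymm (r, s) (0, 1) (1, 0)]
    ring
  · refine ContinuousOn.integrableOn_compact (isCompact_uIcc.prod isCompact_uIcc) ?_
    have hVV : ∀ v w, Continuous fun p => fderiv ℝ (fderiv ℝ V) p v w := fun v w =>
      ((((hV.fderiv_right (m := ∞) (by simp)).fderiv_right (m := ∞) (by simp)).clm_apply
        contDiff_const).clm_apply contDiff_const).continuous
    have hU' : ∀ v, Continuous fun p => fderiv ℝ U p v := fun v =>
      ((hU.fderiv_right (m := ∞) (by simp)).clm_apply contDiff_const).continuous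
    have hc1 := hB.continuous
    have hc2 := fun v => (hV' v).continuous
    have hc3 := S.a_smooth.continuous.comp hU.continuous
    have hc4 := S.b_smooth.continuous.comp hU.continuous
    refine Continuous.continuousOn ?_
    simp only [add_apply, smul_apply,
      ContinuousLinearMap.flip_apply, neg_apply, smul_eq_mul]
    exact ((hc1.mul (hVV _ _)).add ((hc2 _).mul ((hc3.mul hc4).mul (hU' _)))).add
      ((hc1.mul (hVV _ _)).add ((hc2 _).mul ((hc3.mul hc4).mul (hU' _)))).neg

section RotSym

variable {L : ℝ} {a b : AddCircle (1 : ℝ) → ℝ} {ha : ContDiff ℝ ∞ fun x : ℝ => a x}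
  {hb : ContDiff ℝ ∞ fun x : ℝ => b x} {hpos : ∀ x, 0 < a x}
  (hab : ∀ x : ℝ, |deriv (fun t : ℝ => a t) x| < a x * b x)

theorem continuous_of_contDiff_coe (ha : ContDiff ℝ ∞ fun x : ℝ => a x) : Continuous a :=
  QuotientAddGroup.isOpenQuotientMap_mk.continuous_comp_iff.1 ha.continuous

/-- The unit tangent vector at `q` as a unit complex number. -/
def toComplex (a : AddCircle (1 : ℝ) → ℝ) (q : Torus L) (v : Fin 2 → ℝ) : ℂ :=
  ⟨v 0, a q.1 * v 1⟩

theorem norm_toComplex {q : Torus L} {v : Fin 2 → ℝ}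
    (h : (rotSym L a b ha hb hpos).metric q v v = 1) : ‖toComplex a q v‖ = 1 := by
  rw [rotSym_metric] at h
  rw [toComplex, Complex.norm_def, Complex.normSq_mk, sqrt_eq_one]
  linarith

theorem exp_mul_I_eq (θ : ℝ) : Complex.exp (θ * Complex.I) = ⟨cos θ, sin θ⟩ := by
  apply Complex.ext <;> simp [Complex.exp_ofReal_mul_I_re, Complex.exp_ofReal_mul_I_im]

theorem speed_eq_one {γ : ClosedCurve L} (hγ : (rotSym L a b ha hb hpos).IsGeodesic γ.toFun)
    (t : ℝ) : (rotSym L a b ha hb hpos).speed (proj L (γ.toFun t)) (deriv γ.toFun t) = 1 := by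
  rw [MagneticSystem.speed, hγ.2.1 t, sqrt_one]

/-- The angle of a geodesic in the class `Λ⁺` increases by exactly `2π` over a period. -/
theorem angle_add_period {γ : ClosedCurve L} {θ : ℝ → ℝ}
    {H : C(unitInterval × AddCircle (1 : ℝ), (rotSym L a b ha hb hpos).UnitTangent)}
    (hH : (rotSym L a b ha hb hpos).IsHomotopyFromFibre γ H)
    (hγ : (rotSym L a b ha hb hpos).IsGeodesic γ.toFun)
    (hθ : (profile a b ha hb hpos hab).IsOrbit γ.toFun θ) : θ γ.T = θ 0 + 2 * π := by
  obtain ⟨⟨w, hw⟩, h1⟩ := hH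
  -- `projIcc` extends the homotopy to all real `r`, so that the degree argument runs on the whole
  -- plane.
  set G : ℝ × ℝ → (rotSym L a b ha hb hpos).UnitTangent := fun p =>
    H (projIcc 0 1 zero_le_one p.1, (p.2 : AddCircle (1 : ℝ))) with hG
  have hGc : Continuous G := H.continuous.comp
    ((continuous_projIcc.comp continuous_fst).prodMk
      ((AddCircle.continuous_mk' (p := (1 : ℝ))).comp continuous_snd))
  have hac := continuous_of_contDiff_coe ha
  set z : ℝ × ℝ → ℂ := fun p => toComplex a (G p).1.1 (G p).1.2 with hz
  have hzc : Continuous z := by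
    have h2 : Continuous fun p => (G p).1.1.1 :=
      continuous_fst.comp (continuous_fst.comp (continuous_subtype_val.comp hGc))
    have h3 : ∀ i, Continuous fun p => (G p).1.2 i := fun i =>
      (continuous_apply i).comp (continuous_snd.comp (continuous_subtype_val.comp hGc))
    exact Complex.continuous_ofReal.comp (h3 0) |>.add
      ((Complex.continuous_ofReal.comp ((hac.comp h2).mul (h3 1))).mul continuous_const) |>.congr
      fun p => (Complex.mk_eq_add_mul_I _ _).symm
  obtain ⟨θ₀, hc, hs⟩ := exists_cos_sin (u := w.1.2 0) (w := a w.1.1.1 * w.1.2 1) (by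
    have := w.2
    rw [rotSym_metric] at this
    linarith)
  -- The fibre has angle `θ₀ + 2πs`, which grows by `2π` over a period; the lift of the geodesic has
  -- angle `θ (s T)`.
  have key := angle_increment_eq hzc (α := fun s => θ₀ + 2 * π * s) (β := fun s => θ (s * γ.T))
    (fun r s => by simp [hz, hG]) (by fun_prop)
    (hθ.continuous_angle.comp (by fun_prop)) (fun s => ?_) (fun s => ?_) (fun p => ?_)
  · simp only [mul_one, mul_zero, zero_mul, one_mul, add_zero] at key
    linarith
  · have hG0 := hw s
    rw [← show G (0, s) = H (0, (s : AddCircle (1 : ℝ))) by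
      simp only [hG, projIcc_left]; rfl] at hG0
    have := (hpos w.1.1.1).ne'
    simp only [hz, hG0, exp_mul_I_eq, toComplex, rotSym_perp, cos_add, sin_add, hc, hs]
    apply Complex.ext
    · simp; ring
    · simp; field_simp
  · have hG1 := h1 s
    rw [← show G (1, s) = H (1, (s : AddCircle (1 : ℝ))) by
      simp only [hG, projIcc_right]; rfl] at hG1
    rw [speed_eq_one hγ, hθ.deriv_eq] at hG1
    have := (hpos (γ.toFun (s * γ.T) 0 : AddCircle (1 : ℝ))).ne'
    simp only [hz, hG1, exp_mul_I_eq, toComplex]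
    apply Complex.ext <;> simp [proj, profile]
    field_simp
  · rw [← norm_ne_zero_iff, hz, norm_toComplex (G p).2]
    exact one_ne_zero

/-- Facts about a capping disc which hold for all the metrics. -/
theorem cappingDisc_boundary {M : MagneticSystem L} {γ : ClosedCurve L} {Γ : ℝ × ℝ → Fin 2 → ℝ}
    {H : C(unitInterval × AddCircle (1 : ℝ), M.UnitTangent)} (hΓ : Continuous Γ)
    (hH : M.IsHomotopyFromFibre γ H)
    (h : ∀ (r : unitInterval) (s : ℝ), (H (r, (s : AddCircle (1 : ℝ)))).1.1 =
      proj L (Γ ((r : ℝ), s))) :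
    (∀ s, Γ (0, s) = Γ (0, 0)) ∧ (∀ r ∈ Icc (0 : ℝ) 1, ∀ s, Γ (r, s + 1) = Γ (r, s)) ∧
      ∃ d : Fin 2 → ℝ, (∃ m : ℤ, d 0 = m) ∧ ∀ s, Γ (1, s) = γ.toFun (s * γ.T) + d := by
  obtain ⟨⟨w, hw⟩, h1⟩ := hH
  have p0 : ∀ s, Γ (0, s) = Γ (0, 0) := fun s => by
    have hp : ∀ s, proj L (Γ (0, s)) = w.1.1 := fun s => by
      have := h 0 s
      rw [hw s] at this
      exact this.symm
    have := sub_eq_sub_of_proj_eq (u := fun s => Γ (0, s)) (v := fun _ : ℝ => Γ (0, 0))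
      (by fun_prop) continuous_const (fun s => (hp s).trans (hp 0).symm) s 0
    simpa [sub_eq_zero] using this
  refine ⟨p0, fun r hr s => ?_, Γ (1, 0) - γ.toFun (0 * γ.T), ?_, fun s => ?_⟩
  -- `Γ (r, s + 1) - Γ (r, s)` is constant on the strip, and it is zero on `r = 0`, where `Γ` is
  -- constant.
  · have := sub_eq_sub_of_proj_eq (A := unitInterval × ℝ) (L := L)
      (u := fun p => Γ ((p.1 : ℝ), p.2 + 1))
      (v := fun p => Γ ((p.1 : ℝ), p.2)) (by fun_prop) (by fun_prop)
      (fun p => by rw [← h, ← h]; simp) (⟨r, hr⟩, s) (0, 0)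
    simp only [Set.Icc.coe_zero, p0, sub_self] at this
    exact sub_eq_zero.1 this
  · have := h 1 0
    rw [h1 0] at this
    obtain ⟨m, hm⟩ := (proj_eq_iff.1 this.symm).1
    refine ⟨m, ?_⟩
    rw [Pi.sub_apply, sub_eq_iff_eq_add']
    exact hm
  · have := sub_eq_sub_of_proj_eq (L := L) (u := fun s => Γ (1, s))
      (v := fun s : ℝ => γ.toFun (s * γ.T)) (by fun_prop)
      (γ.smooth.continuous.comp (by fun_prop)) (fun s => by
        have := h 1 s
        rw [h1 s] at this
        exact this.symm) s 0
    rw [← this]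
    abel

include hab in
/-- The flux through a capping disc as a boundary integral. -/
theorem flux_eq {γ : ClosedCurve L} {Γ : ℝ × ℝ → Fin 2 → ℝ}
    (hΓ : (rotSym L a b ha hb hpos).IsCappingDisc γ Γ) :
    γ.toFun γ.T = γ.toFun 0 ∧ (rotSym L a b ha hb hpos).flux Γ =
      ∫ t in (0 : ℝ)..γ.T, (profile a b ha hb hpos hab).B (γ.toFun t 0) *
        deriv γ.toFun t 1 := by
  set S := profile a b ha hb hpos hab with hS
  obtain ⟨hΓs, H, hH, h⟩ := hΓ
  obtain ⟨p0, p1, d, ⟨m, hm⟩, pd⟩ := cappingDisc_boundary hΓs.continuous hH h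
  -- The boundary of a disc in the plane is a closed loop, so `γ` closes up in the plane and not
  -- only on the torus.
  have hclosed : γ.toFun γ.T = γ.toFun 0 := by
    have := p1 1 (by simp) 0
    rw [pd, pd] at this
    simpa using this
  refine ⟨hclosed, ?_⟩
  have hcoord : ∀ p v i, fderiv ℝ Γ p v i = fderiv ℝ (fun p => Γ p i) p v := fun p v i => by
    rw [fderiv_apply (hΓs.differentiable (by simp) p)]
    rfl
  have hU : ContDiff ℝ ∞ fun p => Γ p 0 := contDiff_pi.1 hΓs 0
  have hV : ContDiff ℝ ∞ fun p => Γ p 1 := contDiff_pi.1 hΓs 1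
  have hVd := fun p => (hV.differentiable (by simp) p).hasFDerivAt
  have hr : ∀ r s, HasDerivAt (fun r => Γ (r, s) 1) (fderiv ℝ (fun p => Γ p 1) (r, s) (1, 0)) r :=
    fun r s => HasFDerivAt.comp_hasDerivAt (l := fun p => Γ p 1) (f := fun r => (r, s)) r
      (hVd (r, s)) ((hasDerivAt_id r).prodMk (hasDerivAt_const r s))
  have hs : ∀ r s, HasDerivAt (fun s => Γ (r, s) 1) (fderiv ℝ (fun p => Γ p 1) (r, s) (0, 1)) s :=
    fun r s => HasFDerivAt.comp_hasDerivAt (l := fun p => Γ p 1) (f := fun s => (r, s)) s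
      (hVd (r, s)) ((hasDerivAt_const s r).prodMk (hasDerivAt_id s))
  have h0 : ∀ s, fderiv ℝ (fun p => Γ p 1) (0, s) (0, 1) = 0 := fun s => by
    have := hs 0 s
    simp only [p0] at this
    exact this.unique (hasDerivAt_const s _)
  -- The sides `s = 0` and `s = 1` cancel. Periodicity in `s` is known only for `r ∈ [0, 1]`, so the
  -- `r`-derivatives are compared in the open interval.
  have hside : ∫ r in (0 : ℝ)..1, S.B (Γ (r, 1) 0) * fderiv ℝ (fun p => Γ p 1) (r, 1) (1, 0) =
      ∫ r in (0 : ℝ)..1, S.B (Γ (r, 0) 0) * fderiv ℝ (fun p => Γ p 1) (r, 0) (1, 0) := by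
    refine intervalIntegral.integral_congr_Ioo_of_le zero_le_one fun r hr' => ?_
    have e1 : Γ (r, 1) = Γ (r, 0) := by simpa using p1 r (Ioo_subset_Icc_self hr') 0
    have e2 := (hr r 0).congr_of_eventuallyEq (f₁ := fun r => Γ (r, 1) 1) (by
      filter_upwards [Ioo_mem_nhds hr'.1 hr'.2] with r hr'
      have : Γ (r, 1) = Γ (r, 0) := by simpa using p1 r (Ioo_subset_Icc_self hr') 0
      rw [this])
    simp only [e1, (hr r 1).unique e2]
  have hflux : (rotSym L a b ha hb hpos).flux Γ =
      ∫ s in (0 : ℝ)..1, S.B (Γ (1, s) 0) * fderiv ℝ (fun p => Γ p 1) (1, s) (0, 1) := by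
    have := S.integral_pullback hU hV
    rw [hside] at this
    simp only [h0, mul_zero, intervalIntegral.integral_zero, sub_zero, neg_add_cancel,
      zero_add] at this
    rw [← this, MagneticSystem.flux]
    simp only [hcoord, rotSym_areaDensity]
    rfl
  have hγd : ∀ t, HasDerivAt (fun t => γ.toFun t 1) (deriv γ.toFun t 1) t := fun t =>
    Profile.hasDerivAt_one (γ.smooth.differentiable (by simp) t).hasDerivAt
  have h1 : ∀ s, fderiv ℝ (fun p => Γ p 1) (1, s) (0, 1) = deriv γ.toFun (s * γ.T) 1 * γ.T :=
    fun s => by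
      have e1 := hs 1 s
      simp only [pd, Pi.add_apply] at e1
      have e2 := ((hγd (s * γ.T)).comp s ((hasDerivAt_id s).mul_const γ.T)).add_const (d 1)
      rw [one_mul] at e2
      exact e1.unique e2
  -- The boundary of the disc may be a translate of `γ` by a lattice vector. This changes `B` by the
  -- constant `m P`, which integrates to zero against `dy` along a closed curve.
  have hBd : ∀ x, S.B (x + d 0) = S.B x + m * S.P := fun x => by
    have := add_int_mul_of_add_const S.B_add_one x m
    rw [mul_one] at this
    rw [hm, this]
  have hγc : ∀ i, Continuous fun t => γ.toFun t i := fun i =>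
    (continuous_apply i).comp γ.smooth.continuous
  have hγ'c : Continuous fun t => deriv γ.toFun t 1 :=
    (continuous_apply 1).comp (γ.smooth.continuous_deriv (by simp))
  have hBc : Continuous fun t => S.B (γ.toFun t 0) := S.B_smooth.continuous.comp (hγc 0)
  have hsub := intervalIntegral.mul_integral_comp_mul_right (a := 0) (b := 1)
    (f := fun t => (S.B (γ.toFun t 0) + m * S.P) * deriv γ.toFun t 1) γ.T
  rw [zero_mul, one_mul] at hsub
  rw [hflux]
  calc _ = γ.T * ∫ s in (0 : ℝ)..1, (S.B (γ.toFun (s * γ.T) 0) + m * S.P) *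
        deriv γ.toFun (s * γ.T) 1 := by
        rw [← intervalIntegral.integral_const_mul]
        refine intervalIntegral.integral_congr fun s _ => ?_
        simp only [h1, pd, Pi.add_apply, hBd]
        ring
    _ = (∫ t in (0 : ℝ)..γ.T, S.B (γ.toFun t 0) * deriv γ.toFun t 1) +
        ∫ t in (0 : ℝ)..γ.T, m * S.P * deriv γ.toFun t 1 := by
        have i1 : Continuous fun t => S.B (γ.toFun t 0) * deriv γ.toFun t 1 := hBc.mul hγ'c
        have i2 : Continuous fun t => m * S.P * deriv γ.toFun t 1 := continuous_const.mul hγ'c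
        rw [hsub, ← intervalIntegral.integral_add (i1.intervalIntegrable _ _)
          (i2.intervalIntegrable _ _)]
        simp only [add_mul]
    _ = _ := by
        rw [intervalIntegral.integral_const_mul,
          intervalIntegral.integral_eq_sub_of_hasDerivAt (fun t _ => hγd t)
          (hγ'c.intervalIntegrable _ _), hclosed]
        simp

/-- The magnetic length of a geodesic which closes up after a turn. -/
theorem Profile.IsOrbit.length_sub_integral {S : Profile} {c : ℝ → Fin 2 → ℝ} {θ : ℝ → ℝ}
    (h : S.IsOrbit c θ) {T : ℝ} (hT : θ T = θ 0 + 2 * π) (hc : c T = c 0) :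
    S.W (S.clairaut (θ 0) (c 0 0)) = 0 ∧
      T - ∫ t in (0 : ℝ)..T, S.B (c t 0) * deriv c t 1 = S.F (S.clairaut (θ 0) (c 0 0)) := by
  set k := S.clairaut (θ 0) (c 0 0) with hk
  have hW : S.W k = 0 := by
    have := h.y_eq T 0
    rw [hT, S.Y_add_two_pi, hc, sub_self] at this
    linarith
  refine ⟨hW, ?_⟩
  have hcos : Continuous fun t => cos (θ t) ^ 2 := (continuous_cos.comp h.continuous_angle).pow 2
  have hxc : Continuous fun t => c t 0 :=
    continuous_iff_continuousAt.2 fun t => (h.hasDerivAt_x t).continuousAt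
  have hyc : Continuous fun t => deriv c t 1 := by
    simp only [h.deriv_eq]
    exact (continuous_sin.comp h.continuous_angle).div (S.a_smooth.continuous.comp hxc)
      fun t => (S.a_pos _).ne'
  have hyd : ∀ t, HasDerivAt (fun t => c t 1) (deriv c t 1) t := fun t => by
    have := h.hasDerivAt_y t
    rwa [h.deriv_eq t]
  -- Clairaut gives `B = k + a sin θ`, and `y' = sin θ / a`; the term `k y'` integrates to zero and
  -- `sin² θ` is left over, so that subtracting from `T` leaves the integral of `cos² θ`.
  have e1 : ∀ t, S.B (c t 0) * deriv c t 1 = k * deriv c t 1 + (1 - cos (θ t) ^ 2) := fun t => by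
    have h1 : S.B (c t 0) = k + S.a (c t 0) * sin (θ t) := by
      rw [hk, ← h.clairaut_eq t 0, clairaut]; ring
    have := (S.a_pos (c t 0)).ne'
    rw [h1, h.deriv_eq]
    simp only [Matrix.cons_val_one, Matrix.cons_val_fin_one]
    field_simp
    linear_combination S.a (c t 0) * sin_sq_add_cos_sq (θ t)
  have e2 : ∫ t in (0 : ℝ)..T, S.B (c t 0) * deriv c t 1 =
      T - ∫ t in (0 : ℝ)..T, cos (θ t) ^ 2 := by
    simp only [e1]
    have i1 : Continuous fun t => k * deriv c t 1 := continuous_const.mul hyc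
    have i2 : Continuous fun t => 1 - cos (θ t) ^ 2 := continuous_const.sub hcos
    rw [intervalIntegral.integral_add (i1.intervalIntegrable _ _) (i2.intervalIntegrable _ _),
      intervalIntegral.integral_const_mul,
      intervalIntegral.integral_eq_sub_of_hasDerivAt (fun t _ => hyd t)
          (hyc.intervalIntegrable _ _), hc, intervalIntegral.integral_sub (by simp)
          (hcos.intervalIntegrable _ _)]
    simp
  have hdtc : Continuous fun φ => cos φ ^ 2 * S.dt φ k :=
    Continuous.mul (by fun_prop) (S.dt_continuous k)
  have e3 : ∫ t in (0 : ℝ)..T, cos (θ t) ^ 2 = ∫ φ in θ 0..θ T, cos φ ^ 2 * S.dt φ k := by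
    rw [← intervalIntegral.integral_comp_mul_deriv (f := θ) (f' := fun t => (S.dt (θ t) k)⁻¹)
      (g := fun φ => cos φ ^ 2 * S.dt φ k) (fun t _ => h.angle_deriv_eq t)
      (((S.dt_continuous k).comp h.continuous_angle).inv₀
        fun t => (S.dt_pos _ _).ne').continuousOn hdtc]
    refine intervalIntegral.integral_congr fun t _ => ?_
    have := (S.dt_pos (θ t) k).ne'
    simp only [Function.comp]
    field_simp
  have hp : Function.Periodic (fun φ => cos φ ^ 2 * S.dt φ k) (2 * π) := fun φ => by
    have := S.dt_periodic k φ
    simp only at this ⊢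
    rw [this, cos_add_two_pi]
  rw [e2, e3, hT, hp.intervalIntegral_add_eq (θ 0) 0, zero_add, F]
  ring

end RotSym

theorem Profile.angle_add_period (S : Profile) (k θ₀ t : ℝ) :
    S.angle k θ₀ (t + S.τ (2 * π) k) = S.angle k θ₀ t + 2 * π := by
  have := (S.τIso k).apply_symm_apply (t + S.τ θ₀ k)
  rw [τIso_apply] at this
  rw [angle, OrderIso.symm_apply_eq, τIso_apply, τ_add_two_pi, angle, this]
  ring

theorem Profile.orbit_add_period (S : Profile) {k : ℝ} (hk : S.W k = 0) (θ₀ y₀ t : ℝ) :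
    S.orbit k θ₀ y₀ (t + S.τ (2 * π) k) = S.orbit k θ₀ y₀ t := by
  simp only [orbit, S.angle_add_period, S.X_add_two_pi, S.Y_add_two_pi, hk, add_zero]

theorem exists_int_of_cos_eq_of_sin_eq {α β : ℝ} (hcos : cos α = cos β) (hsin : sin α = sin β) :
    ∃ j : ℤ, α = β + j * (2 * π) := by
  have : Complex.exp (α * Complex.I) = Complex.exp (β * Complex.I) := by
    rw [exp_mul_I_eq, exp_mul_I_eq, hcos, hsin]
  obtain ⟨j, hj⟩ := Complex.exp_eq_exp_iff_exists_int.1 this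
  refine ⟨j, ?_⟩
  have := congrArg Complex.im hj
  simpa using this

/-! ### Magnetic lengths are the critical values of `F`; the average of `b`. -/

section RotSym

variable {L : ℝ} {a b : AddCircle (1 : ℝ) → ℝ} {ha : ContDiff ℝ ∞ fun x : ℝ => a x}
  {hb : ContDiff ℝ ∞ fun x : ℝ => b x} {hpos : ∀ x, 0 < a x}
  (hab : ∀ x : ℝ, |deriv (fun t : ℝ => a t) x| < a x * b x)

theorem metric_cos_sin (q : Torus L) (φ : ℝ) :
    (rotSym L a b ha hb hpos).metric q ![cos φ, sin φ / a q.1] ![cos φ, sin φ / a q.1] = 1 := by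
  have := (hpos q.1).ne'
  rw [rotSym_metric]
  simp
  field_simp
  linarith [sin_sq_add_cos_sq φ]

/-- The magnetic length of a geodesic in `Λ⁺`. -/
theorem magneticLength_eq {γ : ClosedCurve L} {Γ : ℝ × ℝ → Fin 2 → ℝ} {θ : ℝ → ℝ}
    (hΓ : (rotSym L a b ha hb hpos).IsCappingDisc γ Γ)
    (hγ : (rotSym L a b ha hb hpos).IsGeodesic γ.toFun)
    (hθ : (profile a b ha hb hpos hab).IsOrbit γ.toFun θ) :
    (profile a b ha hb hpos hab).W
        ((profile a b ha hb hpos hab).clairaut (θ 0) (γ.toFun 0 0)) = 0 ∧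
      (rotSym L a b ha hb hpos).magneticLength γ Γ = (profile a b ha hb hpos hab).F
        ((profile a b ha hb hpos hab).clairaut (θ 0) (γ.toFun 0 0)) := by
  obtain ⟨hclosed, hflux⟩ := flux_eq hab hΓ
  obtain ⟨-, H, hH, -⟩ := hΓ
  obtain ⟨hW, hF⟩ := hθ.length_sub_integral (angle_add_period hab hH hγ hθ) hclosed
  refine ⟨hW, ?_⟩
  rw [MagneticSystem.magneticLength, hflux, ← hF, MagneticSystem.length]
  simp [speed_eq_one hγ]

/-- The critical values of `F` are magnetic lengths. -/
theorem F_mem_magneticLengths {k : ℝ} (hk : (profile a b ha hb hpos hab).W k = 0) :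
    (profile a b ha hb hpos hab).F k ∈ (rotSym L a b ha hb hpos).magneticLengths := by
  set S := profile a b ha hb hpos hab with hS
  set c := S.orbit k 0 0 with hc
  set θ := S.angle k 0 with hθ
  have hcs : ContDiff ℝ ∞ c := S.orbit_smooth k 0 0
  have hO : S.IsOrbit c θ := S.isOrbit_orbit k 0 0
  have hgeo : (rotSym L a b ha hb hpos).IsGeodesic c := (isGeodesic_iff hab).2 ⟨hcs, θ, hO⟩
  set T := S.τ (2 * π) k with hT
  have hθT : ∀ t, θ (t + T) = θ t + 2 * π := S.angle_add_period k 0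
  have hcT : ∀ t, c (t + T) = c t := S.orbit_add_period hk 0 0
  let γ : ClosedCurve L :=
    { toFun := c
      T := T
      T_pos := S.τ_two_pi_pos k
      smooth := hcs
      regular := fun t h0 => by
        have := hgeo.2.1 t
        rw [h0, rotSym_metric] at this
        simp at this
      closed := fun t => by rw [hcT] }
  -- The capping disc is the cone over the loop with apex `c 0`.
  let Γ : ℝ × ℝ → Fin 2 → ℝ := fun p => c 0 + p.1 • (c (p.2 * T) - c 0)
  have hΓ : ContDiff ℝ ∞ Γ := contDiff_const.add (contDiff_fst.smul
    ((hcs.comp (contDiff_snd.mul contDiff_const)).sub contDiff_const))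
  -- Along the cone the angle is interpolated linearly between that of the fibre and that of the
  -- geodesic. Both grow by `2π` over a period, so the unit vector at angle `φ` is periodic in `s`
  -- for every `r`.
  let φ : ℝ × ℝ → ℝ := fun p => (1 - p.1) * (2 * π * p.2) + p.1 * θ (p.2 * T)
  have hφ : Continuous φ := by
    have := hO.continuous_angle
    fun_prop
  have hac := continuous_of_contDiff_coe ha
  let f : unitInterval × ℝ → (rotSym L a b ha hb hpos).UnitTangent := fun p =>
    ⟨(proj L (Γ (p.1, p.2)), ![cos (φ (p.1, p.2)), sin (φ (p.1, p.2)) /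
      a (proj L (Γ (p.1, p.2))).1]), metric_cos_sin _ _⟩
  have hf : Continuous f := by
    have hι : Continuous fun p : unitInterval × ℝ => ((p.1 : ℝ), p.2) := by fun_prop
    have h1 : Continuous fun p : unitInterval × ℝ => proj L (Γ (p.1, p.2)) :=
      (continuous_proj L).comp (hΓ.continuous.comp hι)
    have h2 := hφ.comp hι
    refine (h1.prodMk (continuous_pi fun i => ?_)).subtype_mk _
    fin_cases i
    · exact continuous_cos.comp h2
    · exact (continuous_sin.comp h2).div (hac.comp (continuous_fst.comp h1)) fun _ => (hpos _).ne'
  obtain ⟨H, hH⟩ := exists_continuousMap_of_periodic hf (fun r s => by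
    have e1 : Γ (r, s + 1) = Γ (r, s) := by
      simp only [Γ]; rw [add_mul, one_mul, hcT]
    have e2 : φ (r, s + 1) = φ (r, s) + 2 * π := by
      simp only [φ]; rw [add_mul s, one_mul, hθT]; ring
    refine Subtype.ext ?_
    simp only [f, e1, e2, cos_add_two_pi, sin_add_two_pi])
  have hfib : (rotSym L a b ha hb hpos).IsHomotopyFromFibre γ H := by
    refine ⟨⟨⟨(proj L (c 0), ![cos 0, sin 0 / a (proj L (c 0)).1]), metric_cos_sin _ _⟩,
      fun s => ?_⟩, fun s => ?_⟩
    · rw [hH, rotSym_perp]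
      refine Prod.ext ?_ ?_
      · simp [f, Γ]
      · ext i
        fin_cases i <;> simp [f, Γ, φ, div_eq_mul_inv]
    · rw [hH]
      have h1 : Γ (1, s) = c (s * T) := by simp [Γ]
      have h2 : φ (1, s) = θ (s * T) := by simp [φ]
      have h3 := speed_eq_one (γ := γ) hgeo (s * T)
      have h4 := hO.deriv_eq (s * T)
      refine Prod.ext ?_ ?_
      · exact congrArg (proj L) h1
      · rw [h3, inv_one, one_smul]
        refine Eq.trans ?_ h4.symm
        simp only [f, Set.Icc.coe_one, h1, h2]
        rfl
  have hcap : (rotSym L a b ha hb hpos).IsCappingDisc γ Γ :=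
    ⟨hΓ, H, hfib, fun r s => by rw [hH]⟩
  refine ⟨γ, ⟨⟨H, hfib⟩, hgeo⟩, Γ, hcap, ?_⟩
  rw [(magneticLength_eq hab hcap hgeo hO).2]
  congr 1
  simp only [γ, hc, hθ, Profile.orbit, S.angle_zero, Matrix.cons_val_zero]
  exact (S.clairaut_X 0 k).symm

include hab in
theorem exists_of_mem_magneticLengths {l : ℝ}
    (hl : l ∈ (rotSym L a b ha hb hpos).magneticLengths) :
    ∃ k, l = (profile a b ha hb hpos hab).F k := by
  obtain ⟨γ, ⟨-, hγ⟩, Γ, hΓ, rfl⟩ := hl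
  obtain ⟨-, θ, hθ⟩ := (isGeodesic_iff hab).1 hγ
  exact ⟨_, (magneticLength_eq hab hΓ hγ hθ).2⟩

/-- The integrands do not depend on `y`, so numerator and denominator share a factor `L`. -/
theorem average_eq (hL : 0 < L) : (rotSym L a b ha hb hpos).average =
    (profile a b ha hb hpos hab).P / ∫ x in (0 : ℝ)..1, (profile a b ha hb hpos hab).a x := by
  simp only [MagneticSystem.average, rotSym_areaDensity, Profile.P, Profile.B]
  simp only [rotSym, proj, profile, Matrix.cons_val_zero, intervalIntegral.integral_const,
    sub_zero, smul_eq_mul, intervalIntegral.integral_const_mul]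
  simp only [mul_left_comm _ L, intervalIntegral.integral_const_mul]
  rw [mul_div_mul_left _ _ hL.ne']
  simp only [mul_comm]

theorem pi_div_average (hL : 0 < L) : π / (rotSym L a b ha hb hpos).average =
    (profile a b ha hb hpos hab).mean := by
  rw [average_eq hab hL, Profile.mean, div_div_eq_mul_div]

/-! ### Zoll systems have rational displacements. -/

/-- In a Zoll system the displacement after a turn is a rational multiple of `L`. -/
theorem exists_rat_of_isZoll (hZ : (rotSym L a b ha hb hpos).IsZoll) (k : ℝ) :
    ∃ q : ℚ, (profile a b ha hb hpos hab).W k = q * L := by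
  set S := profile a b ha hb hpos hab with hS
  obtain ⟨Φ, hΦ, ψ, hψ0, -, -, -, hψ⟩ := hZ
  -- A unit vector at angle `0` over `X 0 k`, so that its orbit has Clairaut integral `k`.
  let w : (rotSym L a b ha hb hpos).UnitTangent :=
    ⟨(proj L ![S.X 0 k, 0], ![cos 0, sin 0 / a (proj L ![S.X 0 k, 0]).1]), metric_cos_sin _ _⟩
  obtain ⟨hΦ0, c, hc, hcΦ⟩ := hΦ w
  obtain ⟨σ, hσ⟩ := hψ w
  obtain ⟨-, θ, hO⟩ := (isGeodesic_iff hab).1 hc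
  replace hO : S.IsOrbit c θ := hO
  have hσ0 := hσ 0
  have hσ1 := hσ 1
  have hcoe : ((1 : ℝ) : AddCircle (1 : ℝ)) = 0 := AddCircle.coe_period 1
  rw [hcoe, hψ0] at hσ1
  rw [AddCircle.coe_zero, hψ0] at hσ0
  -- The circle action returns to `w` at parameter `1`, so the orbit has the same position and
  -- velocity at the times `σ 0 < σ 1`. Between them it makes `j` full turns, nonzero because the
  -- angle increases strictly, and `y` moves by `n L = j W(k)`.
  have heq : (proj L (c (σ 1)), deriv c (σ 1)) = (proj L (c (σ 0)), deriv c (σ 0)) := by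
    rw [← hcΦ, ← hcΦ, ← hσ0, ← hσ1]
  obtain ⟨hproj, hder⟩ := Prod.mk.inj heq
  obtain ⟨⟨m, hm⟩, ⟨n, hn⟩⟩ := proj_eq_iff.1 hproj
  have hlt : θ (σ 0) < θ (σ 1) := hO.strictMono (σ.strictMono zero_lt_one)
  rw [hO.deriv_eq, hO.deriv_eq] at hder
  have hax : S.a (c (σ 1) 0) = S.a (c (σ 0) 0) := by
    rw [hm]
    have := S.a_periodic.int_mul m (c (σ 0) 0)
    simpa using this
  have hcos : cos (θ (σ 1)) = cos (θ (σ 0)) := congrFun hder 0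
  have hsin : sin (θ (σ 1)) = sin (θ (σ 0)) := by
    have := congrFun hder 1
    simp only [Matrix.cons_val_one, Matrix.cons_val_fin_one, hax] at this
    exact (div_left_inj' (S.a_pos _).ne').1 this
  obtain ⟨j, hj⟩ := exists_int_of_cos_eq_of_sin_eq hcos hsin
  have hj0 : (j : ℝ) ≠ 0 := by
    rintro h0
    rw [h0] at hj
    linarith
  have hper : ∀ K, S.Y (θ (σ 1)) K = S.Y (θ (σ 0)) K + j * S.W K := fun K => by
    rw [hj]
    exact add_int_mul_of_add_const (f := fun x => S.Y x K) (fun x => S.Y_add_two_pi x K) _ j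
  have hy := hO.y_eq (σ 1) (σ 0)
  rw [hn, hper] at hy
  -- The curve `c` supplied by the flow may start at another lift of the base point of `w`; this
  -- shifts the Clairaut integral by a multiple of `P`, and `W` is `P`-periodic.
  have hk : ∃ i : ℤ, S.clairaut (θ 0) (c 0 0) = k + i * S.P := by
    have hw := hcΦ 0
    rw [hΦ0] at hw
    obtain ⟨hw1, hw2⟩ := Prod.mk.inj (hw : (proj L ![S.X 0 k, 0],
      ![cos 0, sin 0 / a (proj L ![S.X 0 k, 0]).1]) = (proj L (c 0), deriv c 0))
    obtain ⟨i, hi⟩ := (proj_eq_iff.1 hw1.symm).1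
    refine ⟨i, ?_⟩
    rw [hO.deriv_eq] at hw2
    have hs0 : sin (θ 0) = 0 := by
      have := congrFun hw2 1
      simp only [Matrix.cons_val_one, Matrix.cons_val_fin_one, sin_zero, zero_div] at this
      exact (div_eq_zero_iff.1 this.symm).resolve_right (S.a_pos _).ne'
    have hB := add_int_mul_of_add_const S.B_add_one (S.X 0 k) i
    have hk := S.clairaut_X 0 k
    rw [Profile.clairaut, sin_zero, mul_zero, sub_zero] at hk
    rw [Profile.clairaut, hs0, hi, Matrix.cons_val_zero, mul_zero, sub_zero]
    rw [mul_one, hk] at hB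
    exact hB
  obtain ⟨i, hi⟩ := hk
  have hWk : S.W (S.clairaut (θ 0) (c 0 0)) = S.W k := by
    rw [hi]
    have : Function.Periodic S.W S.P := fun c => S.Y_add_P _ c
    exact this.int_mul i k
  rw [hWk] at hy
  refine ⟨n / j, ?_⟩
  push_cast
  field_simp
  linarith

end RotSym

/-! ### The circle action by turning, when every orbit closes after one turn. -/

namespace Profile

variable (S : Profile)

/-- The end point of the orbit segment which starts at `p` with angle `θ` and along which the angle
increases by `δ`. -/
def shift (p : Fin 2 → ℝ) (θ δ : ℝ) : Fin 2 → ℝ :=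
  ![S.X (θ + δ) (S.clairaut θ (p 0)),
    p 1 + (S.Y (θ + δ) (S.clairaut θ (p 0)) - S.Y θ (S.clairaut θ (p 0)))]

theorem shift_zero (p : Fin 2 → ℝ) (θ : ℝ) : S.shift p θ 0 = p := by
  ext i
  fin_cases i
  · simpa [shift] using (S.eq_X (θ := θ) (x := p 0) rfl).symm
  · simp [shift]

theorem shift_shift (p : Fin 2 → ℝ) (θ δ ε : ℝ) :
    S.shift (S.shift p θ δ) (θ + δ) ε = S.shift p θ (δ + ε) := by
  have : S.clairaut (θ + δ) (S.shift p θ δ 0) = S.clairaut θ (p 0) := by simp [shift]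
  rw [shift, this]
  simp [shift, add_assoc]

theorem shift_smooth : ContDiff ℝ ∞ fun z : (Fin 2 → ℝ) × ℝ × ℝ => S.shift z.1 z.2.1 z.2.2 := by
  have h0 : ContDiff ℝ ∞ fun z : (Fin 2 → ℝ) × ℝ × ℝ => z.1 0 :=
    (contDiff_apply ℝ ℝ (0 : Fin 2)).comp contDiff_fst
  have h1 : ContDiff ℝ ∞ fun z : (Fin 2 → ℝ) × ℝ × ℝ => z.1 1 :=
    (contDiff_apply ℝ ℝ (1 : Fin 2)).comp contDiff_fst
  have hθ : ContDiff ℝ ∞ fun z : (Fin 2 → ℝ) × ℝ × ℝ => z.2.1 := by fun_prop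
  have hδ : ContDiff ℝ ∞ fun z : (Fin 2 → ℝ) × ℝ × ℝ => z.2.1 + z.2.2 := by fun_prop
  have hk := contDiff_uncurry_comp S.clairaut_smooth hθ h0
  rw [contDiff_pi]
  intro i
  fin_cases i
  · exact contDiff_uncurry_comp S.X_smooth hδ hk
  · exact h1.add ((contDiff_uncurry_comp S.Y_smooth hδ hk).sub
      (contDiff_uncurry_comp S.Y_smooth hθ hk))

theorem X_add_lattice (θ k : ℝ) (j m : ℤ) :
    S.X (θ + j * (2 * π)) (k + m * S.P) = S.X θ k + m := by
  have h1 := add_int_mul_of_add_const (S.X_add_P (θ + j * (2 * π))) k m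
  have hp : Function.Periodic (fun θ => S.X θ k) (2 * π) := fun θ => S.X_add_two_pi θ k
  have h2 : S.X (θ + j * (2 * π)) k = S.X θ k := hp.int_mul j θ
  rw [h1, h2, mul_one]

theorem Y_add_lattice (hW : ∀ k, S.W k = 0) (θ k : ℝ) (j m : ℤ) :
    S.Y (θ + j * (2 * π)) (k + m * S.P) = S.Y θ k := by
  have hp : Function.Periodic (fun θ => S.Y θ k) (2 * π) := fun θ => by
    simp only [S.Y_add_two_pi, hW, add_zero]
  have hp' : Function.Periodic (fun k => S.Y (θ + j * (2 * π)) k) S.P := fun k => S.Y_add_P _ k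
  exact (hp'.int_mul m k).trans (hp.int_mul j θ)

/-- Deck transformations and the choice of the angle modulo `2π` commute with following an orbit, so
`shift` will descend to the unit tangent bundle. -/
theorem shift_lattice (hW : ∀ k, S.W k = 0) {p q : Fin 2 → ℝ} {m : ℤ} (h0 : p 0 = q 0 + m) {d : ℝ}
    (h1 : p 1 = q 1 + d) (θ δ : ℝ) (j : ℤ) :
    S.shift p (θ + j * (2 * π)) δ 0 = S.shift q θ δ 0 + m ∧
      S.shift p (θ + j * (2 * π)) δ 1 = S.shift q θ δ 1 + d := by
  have hk : S.clairaut (θ + j * (2 * π)) (p 0) = S.clairaut θ (q 0) + m * S.P := by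
    have := add_int_mul_of_add_const (S.clairaut_add_one θ) (q 0) m
    rw [mul_one] at this
    rw [clairaut, sin_add_int_mul_two_pi, h0]
    exact this
  have e : θ + j * (2 * π) + δ = θ + δ + j * (2 * π) := by ring
  simp only [shift, hk, e, S.X_add_lattice, S.Y_add_lattice hW, h1, Matrix.cons_val_zero,
    Matrix.cons_val_one, Matrix.cons_val_fin_one, true_and]
  ring

theorem shift_int_mul_two_pi (hW : ∀ k, S.W k = 0) (p : Fin 2 → ℝ) (θ : ℝ) (j : ℤ) :
    S.shift p θ (j * (2 * π)) = p := by
  have hX := S.X_add_lattice θ (S.clairaut θ (p 0)) j 0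
  have hY := S.Y_add_lattice hW θ (S.clairaut θ (p 0)) j 0
  simp only [Int.cast_zero, zero_mul, add_zero] at hX hY
  rw [shift, hX, hY]
  simpa only [shift, add_zero] using S.shift_zero p θ

end Profile

theorem contDiffAt_arg {z : ℂ} (hz : z ∈ Complex.slitPlane) : ContDiffAt ℝ ∞ Complex.arg z :=
  (Complex.imCLM.contDiff.contDiffAt.comp z
    ((Complex.contDiffAt_log hz).restrict_scalars ℝ)).congr_of_eventuallyEq (Eventually.of_forall fun w => (Complex.log_im w).symm)

section RotSym

variable {L : ℝ} {a b : AddCircle (1 : ℝ) → ℝ} {ha : ContDiff ℝ ∞ fun x : ℝ => a x}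
  {hb : ContDiff ℝ ∞ fun x : ℝ => b x} {hpos : ∀ x, 0 < a x}

variable (L ha hb hpos) in
/-- The unit tangent vector at `proj p` which makes the angle `θ` with `∂_x`. -/
def unitVector (p : Fin 2 → ℝ) (θ : ℝ) : (rotSym L a b ha hb hpos).UnitTangent :=
  ⟨(proj L p, ![cos θ, sin θ / a (proj L p).1]), metric_cos_sin _ _⟩

theorem unitVector_eq_iff {p q : Fin 2 → ℝ} {θ φ : ℝ} :
    unitVector L ha hb hpos p θ = unitVector L ha hb hpos q φ ↔
      proj L p = proj L q ∧ ∃ j : ℤ, θ = φ + j * (2 * π) := by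
  constructor
  · intro h
    obtain ⟨h1, h2⟩ := Prod.mk.inj (show (proj L p, ![cos θ, sin θ / a (proj L p).1]) =
      (proj L q, ![cos φ, sin φ / a (proj L q).1]) from Subtype.ext_iff.1 h)
    rw [h1] at h2
    refine ⟨h1, exists_int_of_cos_eq_of_sin_eq (congrFun h2 0) ?_⟩
    exact (div_left_inj' (hpos _).ne').1 (congrFun h2 1)
  · rintro ⟨h1, j, rfl⟩
    refine Subtype.ext (Prod.ext h1 ?_)
    simp only [unitVector, h1, sin_add_int_mul_two_pi, cos_add_int_mul_two_pi]

theorem exists_unitVector_eq (w : (rotSym L a b ha hb hpos).UnitTangent) :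
    ∃ z : (Fin 2 → ℝ) × ℝ, unitVector L ha hb hpos z.1 z.2 = w := by
  obtain ⟨⟨⟨q₀, q₁⟩, v⟩, hw⟩ := w
  obtain ⟨x, rfl⟩ := QuotientAddGroup.mk_surjective q₀
  obtain ⟨y, rfl⟩ := QuotientAddGroup.mk_surjective q₁
  have h := hw
  rw [rotSym_metric] at h
  obtain ⟨θ, hc, hs⟩ := exists_cos_sin (u := v 0) (w := a (x : AddCircle (1 : ℝ)) * v 1) (by
    linear_combination h)
  refine ⟨(![x, y], θ), Subtype.ext (Prod.ext rfl ?_)⟩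
  ext i
  have := (hpos (x : AddCircle (1 : ℝ))).ne'
  fin_cases i
  · simp [unitVector, hc]
  · simp [unitVector, hs, proj, this]

/-- A point of the plane over the base point of a unit tangent vector, and an angle. -/
def coords (w : (rotSym L a b ha hb hpos).UnitTangent) : (Fin 2 → ℝ) × ℝ :=
  (exists_unitVector_eq w).choose

@[simp] theorem unitVector_coords (w : (rotSym L a b ha hb hpos).UnitTangent) :
    unitVector L ha hb hpos (coords w).1 (coords w).2 = w := (exists_unitVector_eq w).choose_spec

variable (hab : ∀ x : ℝ, |deriv (fun t : ℝ => a t) x| < a x * b x)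

/-- Follow the orbit of a unit tangent vector until its angle has increased by `δ`. -/
def turn (δ : ℝ) (w : (rotSym L a b ha hb hpos).UnitTangent) :
    (rotSym L a b ha hb hpos).UnitTangent :=
  unitVector L ha hb hpos ((profile a b ha hb hpos hab).shift (coords w).1 (coords w).2 δ)
    ((coords w).2 + δ)

/-- The magnetic flow. -/
def magneticFlow (t : ℝ) (w : (rotSym L a b ha hb hpos).UnitTangent) :
    (rotSym L a b ha hb hpos).UnitTangent :=
  turn hab ((profile a b ha hb hpos hab).angle
    ((profile a b ha hb hpos hab).clairaut (coords w).2 ((coords w).1 0)) (coords w).2 t -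
      (coords w).2) w

theorem isFlow_magneticFlow : (rotSym L a b ha hb hpos).IsFlow (magneticFlow hab) := by
  intro w
  set S := profile a b ha hb hpos hab with hS
  set k := S.clairaut (coords w).2 ((coords w).1 0) with hk
  constructor
  · rw [magneticFlow, Profile.angle_zero, sub_self, turn, Profile.shift_zero, add_zero,
      unitVector_coords]
  · have hO := S.isOrbit_orbit k (coords w).2 ((coords w).1 1)
    refine ⟨S.orbit k (coords w).2 ((coords w).1 1), (isGeodesic_iff hab).2
      ⟨S.orbit_smooth _ _ _, _, hO⟩, fun t => ?_⟩
    have hsh : S.shift (coords w).1 (coords w).2 (S.angle k (coords w).2 t - (coords w).2) =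
        S.orbit k (coords w).2 ((coords w).1 1) t := by
      simp only [Profile.shift, Profile.orbit, add_sub_cancel, hk]
    have : magneticFlow hab t w = unitVector L ha hb hpos
        (S.orbit k (coords w).2 ((coords w).1 1) t) (S.angle k (coords w).2 t) := by
      rw [← hsh, magneticFlow, turn, add_sub_cancel]
    rw [this, hO.deriv_eq]
    rfl

variable (hW : ∀ k, (profile a b ha hb hpos hab).W k = 0)
include hW

/-- `turn` is defined through an arbitrary choice of lift and angle in `coords`; by `shift_lattice`
any other choice gives the same result. -/
theorem turn_unitVector (δ : ℝ) (p : Fin 2 → ℝ) (θ : ℝ) :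
    turn hab δ (unitVector L ha hb hpos p θ) =
      unitVector L ha hb hpos ((profile a b ha hb hpos hab).shift p θ δ) (θ + δ) := by
  obtain ⟨h1, j, hj⟩ := unitVector_eq_iff.1 (unitVector_coords (unitVector L ha hb hpos p θ))
  obtain ⟨⟨m, hm⟩, n, hn⟩ := proj_eq_iff.1 h1
  obtain ⟨e0, e1⟩ := (profile a b ha hb hpos hab).shift_lattice hW hm hn θ δ j
  rw [turn, unitVector_eq_iff, hj]
  exact ⟨proj_eq_iff.2 ⟨⟨m, e0⟩, n, e1⟩, j, by ring⟩

theorem turn_add (δ ε : ℝ) (w : (rotSym L a b ha hb hpos).UnitTangent) :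
    turn hab (δ + ε) w = turn hab δ (turn hab ε w) := by
  obtain ⟨⟨p, θ⟩, rfl⟩ := exists_unitVector_eq w
  simp only [turn_unitVector hab hW, Profile.shift_shift, add_comm δ ε, add_assoc]

theorem turn_eq_self_iff (δ : ℝ) (w : (rotSym L a b ha hb hpos).UnitTangent) :
    turn hab δ w = w ↔ ∃ j : ℤ, δ = j * (2 * π) := by
  obtain ⟨⟨p, θ⟩, rfl⟩ := exists_unitVector_eq w
  rw [turn_unitVector hab hW, unitVector_eq_iff]
  refine ⟨fun ⟨_, j, hj⟩ => ⟨j, by simpa using hj⟩, ?_⟩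
  rintro ⟨j, rfl⟩
  refine ⟨?_, j, rfl⟩
  rw [Profile.shift_int_mul_two_pi _ hW]

theorem periodic_turn : Function.Periodic
    (fun s : ℝ => turn (L := L) (ha := ha) (hb := hb) (hpos := hpos) hab (2 * π * s)) 1 := by
  intro s
  funext w
  have h : turn hab (2 * π) w = w := (turn_eq_self_iff hab hW _ w).2 ⟨1, by simp⟩
  simp only
  rw [mul_add, mul_one, turn_add hab hW, h]

/-- In terms of the angle, the pulled-back function is a smooth `G (s, p, θ)`, which is
`2π`-periodic in `θ`. To express it through a nonzero vector, `θ` is replaced by an argument of that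
vector; periodicity of `G` removes the jump of `arg`. -/
theorem isSmoothCircleFamily_turn :
    (rotSym L a b ha hb hpos).IsSmoothCircleFamily (periodic_turn hab hW).lift := by
  set S := profile a b ha hb hpos hab with hS
  rintro f ⟨F, hF, hfF⟩
  let e : ℝ × (Fin 2 → ℝ) × ℝ → Fin 2 → ℝ := fun z => S.shift z.2.1 z.2.2 (2 * π * z.1)
  let G : ℝ × (Fin 2 → ℝ) × ℝ → ℝ := fun z => F (e z, ![cos (z.2.2 + 2 * π * z.1),
    sin (z.2.2 + 2 * π * z.1) / S.a (e z 0)])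
  have he : ContDiff ℝ ∞ e := ContDiff.comp
    (g := fun z : (Fin 2 → ℝ) × ℝ × ℝ => S.shift z.1 z.2.1 z.2.2)
    (f := fun z : ℝ × (Fin 2 → ℝ) × ℝ => (z.2.1, z.2.2, 2 * π * z.1)) S.shift_smooth (by fun_prop)
  have hG : ContDiff ℝ ∞ G := by
    have hθ : ContDiff ℝ ∞ fun z : ℝ × (Fin 2 → ℝ) × ℝ => z.2.2 + 2 * π * z.1 := by fun_prop
    have hv : ContDiff ℝ ∞ fun z : ℝ × (Fin 2 → ℝ) × ℝ => ![cos (z.2.2 + 2 * π * z.1),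
        sin (z.2.2 + 2 * π * z.1) / S.a (e z 0)] := by
      rw [contDiff_pi]
      intro i
      fin_cases i
      · exact contDiff_cos.comp hθ
      · exact (contDiff_sin.comp hθ).div (S.a_smooth.comp (contDiff_pi.1 he 0))
          fun z => (S.a_pos _).ne'
    rw [← contDiffOn_univ]
    refine hF.comp (he.prodMk hv).contDiffOn fun z _ h0 => ?_
    have h1 := congrFun h0 0
    have h2 := congrFun h0 1
    simp only [Matrix.cons_val_zero, Matrix.cons_val_one, Matrix.cons_val_fin_one, Pi.zero_apply,
      div_eq_zero_iff, (S.a_pos _).ne', or_false] at h1 h2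
    have := sin_sq_add_cos_sq (z.2.2 + 2 * π * z.1)
    rw [h1, h2] at this
    norm_num at this
  have hfG : ∀ (s : ℝ) (p : Fin 2 → ℝ) (θ : ℝ),
      f ((periodic_turn hab hW).lift (s : AddCircle (1 : ℝ)) (unitVector L ha hb hpos p θ)) =
        G (s, p, θ) := fun s p θ => by
    have h : (periodic_turn hab hW).lift (s : AddCircle (1 : ℝ)) (unitVector L ha hb hpos p θ) =
        unitVector L ha hb hpos (e (s, p, θ)) (θ + 2 * π * s) := by
      rw [← turn_unitVector hab hW]
      exact congrFun ((periodic_turn hab hW).lift_coe s) _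
    rw [h]
    exact hfF _ _ _
  have hGper : ∀ s p θ (j : ℤ), G (s, p, θ + j * (2 * π)) = G (s, p, θ) := fun s p θ j => by
    rw [← hfG, ← hfG, unitVector_eq_iff.2 ⟨rfl, j, rfl⟩]
  let Z : ℝ × (Fin 2 → ℝ) × (Fin 2 → ℝ) → ℂ := fun z => ⟨z.2.2 0, S.a (z.2.1 0) * z.2.2 1⟩
  have hZ : ContDiff ℝ ∞ Z := by
    have h0 : ContDiff ℝ ∞ fun z : ℝ × (Fin 2 → ℝ) × (Fin 2 → ℝ) => z.2.2 0 := by fun_prop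
    have h1 : ContDiff ℝ ∞ fun z : ℝ × (Fin 2 → ℝ) × (Fin 2 → ℝ) => S.a (z.2.1 0) * z.2.2 1 :=
      (S.a_smooth.comp (by fun_prop)).mul (by fun_prop)
    exact Complex.equivRealProdCLM.symm.contDiff.comp (h0.prodMk h1)
  -- Off the slit plane `arg` is replaced by `arg (-Z) + π`, which is smooth there and differs from
  -- `arg Z` by a multiple of `2π`.
  have harg : ∀ z, Z z ≠ 0 →
      G (z.1, z.2.1, Complex.arg (Z z)) = G (z.1, z.2.1, Complex.arg (-Z z) + π) := fun z hz => by
    obtain ⟨j, hj⟩ := Real.Angle.angle_eq_iff_two_pi_dvd_sub.1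
      ((Complex.arg_neg_coe_angle hz).trans (Real.Angle.coe_add _ _).symm)
    rw [show Complex.arg (-Z z) + π = Complex.arg (Z z) + (j + 1 : ℤ) * (2 * π) by
      push_cast; linarith, hGper]
  refine ⟨fun z => G (z.1, z.2.1, Complex.arg (Z z)), fun z hz => ContDiffAt.contDiffWithinAt ?_,
    fun s p v h => ?_⟩
  · have hZ0 : Z z ≠ 0 := fun h0 => hz <| by
      have h1 : z.2.2 0 = 0 := congrArg Complex.re h0
      have h2 : S.a (z.2.1 0) * z.2.2 1 = 0 := congrArg Complex.im h0
      replace h2 := (mul_eq_zero.1 h2).resolve_left (S.a_pos _).ne'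
      ext i
      fin_cases i
      · exact h1
      · exact h2
    have hcomp : ∀ {φ : ℝ × (Fin 2 → ℝ) × (Fin 2 → ℝ) → ℝ}, ContDiffAt ℝ ∞ φ z →
        ContDiffAt ℝ ∞ (fun z => G (z.1, z.2.1, φ z)) z := fun hφ =>
      hG.contDiffAt.comp z (contDiffAt_fst.prodMk
        ((contDiff_fst.comp contDiff_snd).contDiffAt.prodMk hφ))
    by_cases hs : Z z ∈ Complex.slitPlane
    · exact hcomp ((contDiffAt_arg hs).comp z hZ.contDiffAt)
    · have hs' : -Z z ∈ Complex.slitPlane := by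
        rw [Complex.mem_slitPlane_iff] at hs ⊢
        push Not at hs
        refine Or.inl (neg_pos.2 (lt_of_le_of_ne hs.1 fun h0 => hZ0 (Complex.ext h0 hs.2)))
      refine (hcomp (((contDiffAt_arg hs').comp z hZ.neg.contDiffAt).add
        (contDiffAt_const (c := π)))).congr_of_eventuallyEq ?_
      filter_upwards [hZ.continuous.continuousAt.eventually_ne hZ0] with z hz
      exact harg z hz
  · have hn : ‖Z (s, p, v)‖ = 1 := norm_toComplex h
    have hn0 : Z (s, p, v) ≠ 0 := norm_ne_zero_iff.1 (by rw [hn]; exact one_ne_zero)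
    have huv : (⟨(proj L p, v), h⟩ : (rotSym L a b ha hb hpos).UnitTangent) =
        unitVector L ha hb hpos p (Complex.arg (Z (s, p, v))) := by
      refine Subtype.ext (Prod.ext rfl ?_)
      have := (hpos (p 0 : AddCircle (1 : ℝ))).ne'
      ext i
      fin_cases i
      · simp [unitVector, Complex.cos_arg hn0, hn, Z]
      · change v 1 = sin (Complex.arg (Z (s, p, v))) / a (p 0 : AddCircle (1 : ℝ))
        rw [Complex.sin_arg, hn, div_one, eq_div_iff this, mul_comm]
        rfl
    rw [huv, hfG]

/-- The element `s` of the circle advances the angle by `2π s` along the orbit. This is free because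
a unit vector determines its angle modulo `2π`. -/
theorem isZoll_of_W_eq_zero : (rotSym L a b ha hb hpos).IsZoll := by
  set S := profile a b ha hb hpos hab with hS
  refine ⟨magneticFlow hab, isFlow_magneticFlow hab, (periodic_turn hab hW).lift, fun w => ?_,
    fun s t w => ?_, fun s w h => ?_, isSmoothCircleFamily_turn hab hW, fun w => ?_⟩
  · have := congrFun ((periodic_turn (L := L) hab hW).lift_coe 0) w
    refine this.trans ((turn_eq_self_iff hab hW _ w).2 ⟨0, by simp⟩)
  · obtain ⟨s, rfl⟩ := QuotientAddGroup.mk_surjective s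
    obtain ⟨t, rfl⟩ := QuotientAddGroup.mk_surjective t
    have := turn_add hab hW (2 * π * s) (2 * π * t) w
    rw [← mul_add] at this
    exact this
  · obtain ⟨s, rfl⟩ := QuotientAddGroup.mk_surjective s
    obtain ⟨j, hj⟩ := (turn_eq_self_iff hab hW (2 * π * s) w).1 h
    refine (AddCircle.coe_eq_zero_iff 1).2 ⟨j, ?_⟩
    have := two_pi_pos.ne'
    rw [zsmul_eq_mul, mul_one]
    exact mul_left_cancel₀ this (by linarith)
  · set θ := (coords w).2
    set k := S.clairaut θ ((coords w).1 0) with hk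
    -- The reparametrisation sends `s` to the time the flow needs to advance the angle from `θ` to
    -- `θ + 2π s`.
    have hmono : StrictMono fun s : ℝ => S.τ (θ + 2 * π * s) k - S.τ θ k := fun s t hst =>
      sub_lt_sub_right (S.τ_strictMono k (by
        have := mul_lt_mul_of_pos_left hst two_pi_pos
        linarith)) _
    have hsurj : Function.Surjective fun s : ℝ => S.τ (θ + 2 * π * s) k - S.τ θ k := fun u => by
      obtain ⟨φ, hφ⟩ := S.τ_surjective k (u + S.τ θ k)
      refine ⟨(φ - θ) / (2 * π), ?_⟩
      have := two_pi_pos.ne'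
      have e : θ + 2 * π * ((φ - θ) / (2 * π)) = φ := by field_simp; ring
      simp only at hφ ⊢
      rw [e, hφ]
      ring
    refine ⟨hmono.orderIsoOfSurjective _ hsurj, fun s => ?_⟩
    have hang : S.angle k θ (S.τ (θ + 2 * π * s) k - S.τ θ k) = θ + 2 * π * s := by
      rw [Profile.angle, sub_add_cancel, ← Profile.τIso_apply, OrderIso.symm_apply_apply]
    have : magneticFlow hab (S.τ (θ + 2 * π * s) k - S.τ θ k) w = turn hab (2 * π * s) w := by
      rw [magneticFlow, hang, add_sub_cancel_left]
    exact this.symm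

end RotSym

end MagneticTorus

end

/-! ### The inequality and the case of equality. -/

theorem theorem2p2 (L : ℝ) (hL : 0 < L) (a b : AddCircle (1 : ℝ) → ℝ)
    (ha : ContDiff ℝ ∞ fun x : ℝ => a x) (hb : ContDiff ℝ ∞ fun x : ℝ => b x)
    (hpos : ∀ x, 0 < a x)
    (hab : ∀ x : ℝ, |deriv (fun t : ℝ => a t) x| < a x * b x) :
    ∃ m : ℝ, IsGLB (MagneticTorus.rotSym L a b ha hb hpos).magneticLengths m ∧
      m ≤ Real.pi / (MagneticTorus.rotSym L a b ha hb hpos).average ∧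
      (m = Real.pi / (MagneticTorus.rotSym L a b ha hb hpos).average ↔
        (MagneticTorus.rotSym L a b ha hb hpos).IsZoll) := by
  set S := MagneticTorus.profile a b ha hb hpos hab with hS
  obtain ⟨k, hk⟩ := S.exists_isMinOn_F
  -- At a minimum of `F` one has `W = F' = 0`, so the minimum is itself a magnetic length: the
  -- infimum is attained, and in particular the set is non-empty.
  have hmem := MagneticTorus.F_mem_magneticLengths (L := L) hab (S.W_eq_zero_of_isMin hk)
  refine ⟨S.F k, IsLeast.isGLB ⟨hmem, fun l hl => ?_⟩, ?_⟩
  · obtain ⟨k', rfl⟩ := MagneticTorus.exists_of_mem_magneticLengths hab hl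
    exact hk k'
  · rw [MagneticTorus.pi_div_average hab hL]
    refine ⟨S.le_mean hk, fun h => ?_, fun hZ => ?_⟩
    · refine MagneticTorus.isZoll_of_W_eq_zero hab (S.W_eq_zero_of_F_const (m := S.mean) ?_)
      exact S.F_eq_mean_of_forall_le (h ▸ hk)
    · exact S.F_eq_mean_of_W_eq_zero
        (S.W_eq_zero_of_rational (MagneticTorus.exists_rat_of_isZoll hab hZ)) k
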